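/- Let $n\in\mathbb{N}$ and let $G$ be a group isomorphic to the alternating group $A_n$ or to the symmetric group $S_n$. Suppose that $G$ acts faithfully, transitively and nonregularly on a set $\Omega$, that the pointwise stabilizer of any four pairwise distinct points of $\Omega$ is trivial, and that the pointwise stabilizer of some three pairwise distinct points of $\Omega$ is nontrivial. Then $n\in\{5,6,7,8\}$ and one of the following holds: (1) $n=5$, $G\cong A_5$ or $G\cong S_5$, $|\Omega|=15$, and the action of $G$ is as on the set of cosets of a Sylow $2$-subgroup of $G$. (2) $n=5$, $G\cong S_5$, $|\Omega|=5$, and $G$ acts naturally. (3) $n=6$, $G\cong A_6$, $|\Omega|=6$, and $G$ acts naturally. (4) $n=6$, $G\cong A_6$, $|\Omega|=15$, and the action of $G$ is as on the set of cosets of a subgroup of order $24$. (5) $n=7$, $G\cong A_7$, $|\Omega|=15$, and the action of $G$ is as on the set of cosets of a subgroup isomorphic to $\mathrm{PSL}_2(7)$. (6) $n=7$, $G\cong A_7$, $|\Omega|=360$, and the action of $G$ is as on the set of cosets of a Sylow $7$-subgroup of $G$. (7) $n=8$, $G\cong A_8$, $|\Omega|=2880$, and the action of $G$ is as on the set of cosets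 of a Sylow $7$-subgroup of $G$. Here "the action is as on the set of cosets of $H$" means that there is a $G$-equivariant bijection $\Omega\to G/H$, and "acts naturally" means that the action is permutation isomorphic to the natural action of $S_5$ on $5$ points, respectively of $A_6$ on $6$ points. -/

import Mathlib

/-- `G` acts faithfully and transitively, but not regularly, on `Ω`, every (pointwise) stabilizer of
four pairwise distinct points is trivial, and some (pointwise) stabilizer of three pairwise
distinct points is nontrivial. -/
structure IsThreeFixAction (G Ω : Type*) [Group G] [MulAction G Ω] : Prop where
  faithful : FaithfulSMul G Ω
  transitive : MulAction.IsPretransitive G Ω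
  nonregular : ∃ a : Ω, MulAction.stabilizer G a ≠ ⊥
  four_point : ∀ a b c d : Ω, a ≠ b → a ≠ c → a ≠ d → b ≠ c → b ≠ d → c ≠ d →
    MulAction.stabilizer G a ⊓ MulAction.stabilizer G b ⊓
      MulAction.stabilizer G c ⊓ MulAction.stabilizer G d = ⊥
  three_point : ∃ a b c : Ω, a ≠ b ∧ a ≠ c ∧ b ≠ c ∧
    MulAction.stabilizer G a ⊓ MulAction.stabilizer G b ⊓ MulAction.stabilizer G c ≠ ⊥

/-- The action of `G` on `Ω` is as on the set of cosets of the subgroup `H`: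
there is a `G`-equivariant bijection from `Ω` to `G ⧸ H`. -/
def ActsAsOnCosets (G Ω : Type*) [Group G] [MulAction G Ω] (H : Subgroup G) : Prop :=
  ∃ e : Ω ≃ G ⧸ H, ∀ (g : G) (x : Ω), e (g • x) = g • e x

/-- `G` acts on `Ω` as the symmetric group of degree `n` acts naturally on `n` points:
the action is permutation isomorphic to that of `Equiv.Perm (Fin n)` on `Fin n`. -/
def ActsAsNaturalSymmetric (n : ℕ) (G Ω : Type*) [Group G] [MulAction G Ω] : Prop :=
  ∃ (φ : G ≃* Equiv.Perm (Fin n)) (e : Ω ≃ Fin n), ∀ (g : G) (x : Ω), e (g • x) = φ g (e x)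

/-- `G` acts on `Ω` as the alternating group of degree `n` acts naturally on `n` points:
the action is permutation isomorphic to that of `alternatingGroup (Fin n)` on `Fin n`. -/
def ActsAsNaturalAlternating (n : ℕ) (G Ω : Type*) [Group G] [MulAction G Ω] : Prop :=
  ∃ (φ : G ≃* alternatingGroup (Fin n)) (e : Ω ≃ Fin n),
    ∀ (g : G) (x : Ω), e (g • x) = (φ g : Equiv.Perm (Fin n)) (e x)

/-! By transitivity `Ω` is `G ⧸ H` for a point stabilizer `H`, and the four-point condition says
that a nontrivial `x ∈ H` fixes at most three cosets of `H` (`AtMostThree`). Whatever normalizes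
`⟨x⟩` permutes these few cosets, so much of the normalizer is forced into `H`: this is the content
of `pow_mem_or`, `klein`, `three` and `mem_of_tetrahedral`. Permutations have large normalizers, so
a nontrivial `H` tends to grow until it contains the alternating group, which faithfulness forbids.

For `n ≥ 7`, taking an element of least prime order in `H` shows that `H` contains a transposition,
a three-cycle or a double transposition, unless `n ≤ 8` and `H` has order 7 (`exists_cycleType`).
One three-cycle spreads to all of them (`threeCycle_step`). Transpositions produce three-cycles, and
so do double transpositions if `n ≥ 8`. What remains is order 7, or `n = 7` with double
transpositions but no three-cycles. In the latter case `H` contains generators of `PSL₂(7)`, and the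
order of `A₇` leaves only equality. In symmetric groups the additional odd elements eliminate both
cases.

For `n ≤ 6` arithmetic takes over. Some element of prime order `p` fixes exactly three points, so
`|Ω| ≡ 3` modulo `p` with `p` dividing `|H|`; this settles `n ≤ 4` and leaves few degrees for `n =
5`. For `n = 6` the number of fixed points depends only on the cycle type, and Burnside's lemma
together with congruences between an element and its powers becomes a finite search. Its surviving
solutions are the two actions of `A₆`, and for `S₆` a configuration refuted by Klein four-groups. -/

open Equiv Equiv.Perm

/-- Inside `Γ`, every nontrivial element of `H` fixes at most three cosets of `H`. -/
def AtMostThree {M : Type*} [Group M] (Γ H : Subgroup M) : Prop :=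
  ∀ x ∈ H, x ≠ 1 → ∀ a ∈ Γ, ∀ b ∈ Γ, ∀ c ∈ Γ,
    a⁻¹ * x * a ∈ H → b⁻¹ * x * b ∈ H → c⁻¹ * x * c ∈ H →
    a ∈ H ∨ b ∈ H ∨ c ∈ H ∨ a⁻¹ * b ∈ H ∨ a⁻¹ * c ∈ H ∨ b⁻¹ * c ∈ H

theorem mem_of_eq {M : Type*} [Group M] {H : Subgroup M} {a b : M} (e : a = b) (ha : a ∈ H) :
    b ∈ H :=
  e ▸ ha

/-! ### Consequences of the fixed-coset bound in an arbitrary group -/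

namespace AtMostThree

section Group

variable {M M' : Type*} [Group M] [Group M'] {Γ H : Subgroup M}

theorem comap (h : AtMostThree Γ H) {φ : M' →* M} (hφ : Function.Injective φ) :
    AtMostThree (Γ.comap φ) (H.comap φ) := by
  intro x hx hx1 a ha b hb c hc hxa hxb hxc
  have := h (φ x) hx (fun h0 => hx1 (hφ (by simpa using h0))) (φ a) ha (φ b) hb (φ c) hc
    (by simpa using hxa) (by simpa using hxb) (by simpa using hxc)
  simpa using this

/-- Conjugating `x` by powers of `u` gives powers of `x`, so `x` fixes the cosets of `1, u, u ^ 2, u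
^ 3`, and two of these must coincide. -/
theorem pow_mem_or (h : AtMostThree Γ H) {x u : M} (hx : x ∈ H) (hx1 : x ≠ 1) (hu : u ∈ Γ)
    (k : ℕ) (hk : u⁻¹ * x * u = x ^ k) : u ∈ H ∨ u ^ 2 ∈ H ∨ u ^ 3 ∈ H := by
  have h2 : (u ^ 2)⁻¹ * x * u ^ 2 = (x ^ k) ^ k := by
    have : (u ^ 2)⁻¹ * x * u ^ 2 = u⁻¹ * (u⁻¹ * x * u) * (u⁻¹)⁻¹ := by
      simp only [sq, mul_inv_rev, inv_inv, mul_assoc]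
    rw [this, hk, ← conj_pow, inv_inv, hk]
  have h3 : (u ^ 3)⁻¹ * x * u ^ 3 = ((x ^ k) ^ k) ^ k := by
    have : (u ^ 3)⁻¹ * x * u ^ 3 = u⁻¹ * ((u ^ 2)⁻¹ * x * u ^ 2) * (u⁻¹)⁻¹ := by
      simp only [pow_succ, pow_zero, one_mul, mul_inv_rev, inv_inv, mul_assoc]
    rw [this, h2, ← conj_pow, ← conj_pow, inv_inv, hk]
  have h4 := h x hx hx1 u hu (u ^ 2) (pow_mem hu 2) (u ^ 3) (pow_mem hu 3)
    (hk ▸ pow_mem hx k) (h2 ▸ pow_mem (pow_mem hx k) k)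
    (h3 ▸ pow_mem (pow_mem (pow_mem hx k) k) k)
  have e1 : u⁻¹ * u ^ 2 = u := by group
  have e2 : u⁻¹ * u ^ 3 = u ^ 2 := by group
  have e3 : (u ^ 2)⁻¹ * u ^ 3 = u := by group
  rw [e1, e2, e3] at h4
  tauto

/-- The exponents 1, 2, 3 from `pow_mem_or` are prime to `p ≥ 5`, so `u` is a power of whichever
power lies in `H`. -/
theorem mem_of_pow_prime_eq_one (h : AtMostThree Γ H) {x u : M} (hx : x ∈ H) (hx1 : x ≠ 1)
    (hu : u ∈ Γ) (hxu : x * u = u * x) {p : ℕ} (hp : p.Prime) (hp5 : 5 ≤ p) (hup : u ^ p = 1) :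
    u ∈ H := by
  have key : ∀ i, 0 < i → i < p → u ^ i ∈ H → u ∈ H := by
    intro i hi hip hm
    have hc : Nat.Coprime (orderOf u) i :=
      Nat.Coprime.coprime_dvd_left (orderOf_dvd_of_pow_eq_one hup)
        (Nat.coprime_of_lt_prime hi.ne' hip hp)
    obtain ⟨m, hm'⟩ := exists_pow_eq_self_of_coprime hc.symm
    exact hm' ▸ pow_mem hm m
  rcases h.pow_mem_or hx hx1 hu 1 (by rw [mul_assoc, hxu]; group) with h1 | h1 | h1
  · exact h1
  · exact key 2 (by omega) (by omega) h1
  · exact key 3 (by omega) (by omega) h1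

/-- A Klein four-group centralizing a nontrivial element of `H` meets `H`. -/
theorem klein (h : AtMostThree Γ H) {x a b : M} (hx : x ∈ H) (hx1 : x ≠ 1) (ha : a ∈ Γ)
    (hb : b ∈ Γ) (hxa : x * a = a * x) (hxb : x * b = b * x) (hab : a * b = b * a)
    (ha2 : a * a = 1) :
    a ∈ H ∨ b ∈ H ∨ a * b ∈ H := by
  have ha' : a⁻¹ = a := by rw [inv_eq_iff_mul_eq_one, ha2]
  have hxab : x * (a * b) = a * b * x := by rw [← mul_assoc, hxa, mul_assoc, hxb, mul_assoc]
  have h4 := h x hx hx1 a ha b hb (a * b) (mul_mem ha hb)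
    (by rw [mul_assoc, hxa]; simpa using hx) (by rw [mul_assoc, hxb]; simpa using hx)
    (by rw [mul_assoc, hxab, inv_mul_cancel_left]; exact hx)
  have e1 : b⁻¹ * (a * b) = a := by rw [hab]; group
  rw [e1, ha', ← mul_assoc, ha2, one_mul] at h4
  tauto

/-- If `z` of order three and `t` both preserve the fixed points of `x`, then `z ∈ H` or
`z ^ i * t ∈ H` for some `i`. -/
theorem three (h : AtMostThree Γ H) {x z t : M} (hx : x ∈ H) (hx1 : x ≠ 1) (hz : z ∈ Γ)
    (ht : t ∈ Γ) (hz3 : z ^ 3 = 1) (hxz : z⁻¹ * x * z ∈ H) (hxz' : z * x * z⁻¹ ∈ H)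
    (hxt : t⁻¹ * x * t ∈ H) :
    z ∈ H ∨ t ∈ H ∨ z * t ∈ H ∨ z⁻¹ * t ∈ H := by
  have h4 := h x hx hx1 z hz z⁻¹ (inv_mem hz) t ht hxz (by simpa using hxz') hxt
  have e : z⁻¹ * z⁻¹ = z := by
    rw [← mul_inv_rev, inv_eq_iff_mul_eq_one, mul_assoc, ← sq, ← pow_succ', hz3]
  rw [e, inv_inv, inv_mem_iff] at h4
  tauto

/-- The Klein four-subgroup of a group `A₄` centralizing a nontrivial element of `H` lies
in `H`. -/
theorem mem_of_tetrahedral (h : AtMostThree Γ H) {x y v w : M} (hx : x ∈ H)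
    (hy : y ∈ Γ) (hv : v ∈ Γ) (hw : w ∈ Γ)
    (hc : x ≠ 1 ∧ x * y = y * x ∧ x * v = v * x ∧ x * w = w * x)
    (hr : y ^ 3 = 1 ∧ v * v = 1 ∧ w * w = 1 ∧ v * w = w * v ∧ y * v = w * y ∧
      y * w = v * w * y) : v ∈ H := by
  obtain ⟨hx1, hxy, hxv, hxw⟩ := hc
  obtain ⟨hy3, hv2, hw2, hvw, hyv, hyw⟩ := hr
  have hv' : v⁻¹ = v := by rw [inv_eq_iff_mul_eq_one, hv2]
  have c1 : y⁻¹ * w * y = v := by rw [mul_assoc, ← hyv]; group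
  have c2 : y * (v * w) * y⁻¹ = v := by
    rw [← mul_assoc y, hyv, mul_assoc w, hyw, ← mul_assoc w, ← mul_assoc w, ← hvw, mul_assoc v w,
      hw2]
    group
  have f1 : v⁻¹ * v * v = v := by group
  have f2 : v * (v * w) * v⁻¹ = v * w := by
    rw [hvw, mul_assoc, mul_assoc w, mul_inv_cancel, mul_one, hvw]
  have f3 : v * w * v⁻¹ = w := by rw [hvw]; group
  -- The relations say that conjugation by `y` rotates `v`, `w`, `v * w`. If the involution found in
  -- `H` is not `v`, then `H` contains `v` or one of `y`, `y * v`, `y⁻¹ * v`. Since `v` centralizes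
  -- the four-group, each of the latter rotates it as `y` or `y⁻¹` does and carries the known
  -- involution, in one direction or the other, to `v`.
  rcases h.klein hx hx1 hv hw hxv hxw hvw hv2 with hk | hk | hk
  · exact hk
  all_goals
    rcases h.three hx hx1 hy hv hy3 (by rw [mul_assoc, hxy]; simpa using hx)
      (by rw [← hxy]; simpa using hx) (by rw [mul_assoc, hxv]; simpa using hx)
      with hq | hq | hq | hq
  · exact c1 ▸ mul_mem (mul_mem (inv_mem hq) hk) hq
  · exact hq
  · have := mul_mem (mul_mem (inv_mem hq) hk) hq
    rwa [show (y * v)⁻¹ * w * (y * v) = v⁻¹ * (y⁻¹ * w * y) * v by group, c1, f1] at this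
  · have := mul_mem (mul_mem hq hk) (inv_mem hq)
    rwa [show y⁻¹ * v * w * (y⁻¹ * v)⁻¹ = y⁻¹ * (v * w * v⁻¹) * y by group, f3, c1] at this
  · exact c2 ▸ mul_mem (mul_mem hq hk) (inv_mem hq)
  · exact hq
  · have := mul_mem (mul_mem hq hk) (inv_mem hq)
    rwa [show y * v * (v * w) * (y * v)⁻¹ = y * (v * (v * w) * v⁻¹) * y⁻¹ by group, f2, c2]
      at this
  · have := mul_mem (mul_mem (inv_mem hq) hk) hq
    rwa [show (y⁻¹ * v)⁻¹ * (v * w) * (y⁻¹ * v) = v⁻¹ * (y * (v * w) * y⁻¹) * v by group, c2,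
      f1] at this

end Group

end AtMostThree

/-! ### Transport of permutations along embeddings -/

section Embedding

variable {α β : Type*}

theorem conj_viaEmbeddingHom (f g : β ↪ α) (σ : Perm β) (x : Perm α) (hx : ∀ i, x (f i) = g i) :
    x * viaEmbeddingHom f σ * x⁻¹ = viaEmbeddingHom g σ := by
  rw [mul_inv_eq_iff_eq_mul]
  ext a
  by_cases ha : a ∈ Set.range f
  · obtain ⟨i, rfl⟩ := ha
    simp [viaEmbeddingHom_apply, viaEmbedding_apply, hx]
  · have ha' : x a ∉ Set.range g := by
      rintro ⟨i, hi⟩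
      rw [← hx i] at hi
      exact ha ⟨i, x.injective hi⟩
    simp [viaEmbeddingHom_apply, viaEmbedding_apply_of_notMem _ _ _ ha,
      viaEmbedding_apply_of_notMem _ _ _ ha']

theorem viaEmbeddingHom_trans_perm (f : β ↪ α) (τ σ : Perm β) :
    viaEmbeddingHom (τ.toEmbedding.trans f) σ = viaEmbeddingHom f (τ * σ * τ⁻¹) := by
  rw [map_mul, map_mul, map_inv]
  refine (conj_viaEmbeddingHom _ _ _ _ fun i => ?_).symm
  simp [viaEmbeddingHom_apply, viaEmbedding_apply]

theorem conj_viaEmbeddingHom_of_semiconj (f : β ↪ α) (τ σ : Perm β) (x : Perm α)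
    (hx : ∀ i, x (f i) = f (τ i)) :
    x * viaEmbeddingHom f σ * x⁻¹ = viaEmbeddingHom f (τ * σ * τ⁻¹) := by
  rw [← viaEmbeddingHom_trans_perm]
  exact conj_viaEmbeddingHom _ _ _ _ hx

theorem AtMostThree.comap_viaEmbedding {Γ H : Subgroup (Perm α)} (h : AtMostThree Γ H)
    (f : β ↪ α) :
    AtMostThree (Γ.comap (viaEmbeddingHom f)) (H.comap (viaEmbeddingHom f)) :=
  h.comap (viaEmbeddingHom_injective f)

variable [Fintype α] [DecidableEq α] [Fintype β] [DecidableEq β]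

theorem sign_viaEmbeddingHom (f : β ↪ α) (σ : Perm β) :
    sign (viaEmbeddingHom f σ) = sign σ := by
  rw [viaEmbeddingHom_apply, viaEmbedding]
  convert sign_extendDomain σ _

theorem cycleType_viaEmbeddingHom (f : β ↪ α) (σ : Perm β) :
    (viaEmbeddingHom f σ).cycleType = σ.cycleType := by
  rw [viaEmbeddingHom_apply, viaEmbedding]
  convert cycleType_extendDomain _

/-- Equal cycle types mean conjugate, and the conjugating permutation can be absorbed into the
embedding. This reduces arguments in any degree to explicit permutations of a small `Fin k`, where
relations are decidable. -/
theorem exists_viaEmbeddingHom_eq {σ : Perm α} {τ : Perm β} (h : σ.cycleType = τ.cycleType)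
    (hc : Fintype.card β ≤ Fintype.card α) : ∃ f : β ↪ α, viaEmbeddingHom f τ = σ := by
  obtain ⟨f⟩ := Function.Embedding.nonempty_of_card_le hc
  have : IsConj (viaEmbeddingHom f τ) σ := by
    rw [isConj_iff_cycleType_eq, cycleType_viaEmbeddingHom, h]
  obtain ⟨c, hc⟩ := isConj_iff.1 this
  exact ⟨f.trans c.toEmbedding, by
    rw [← hc, conj_viaEmbeddingHom f (f.trans c.toEmbedding) τ c fun i => rfl]⟩

theorem alternatingGroup_le_comap {Γ : Subgroup (Perm α)} (hΓ : ∀ σ, sign σ = 1 → σ ∈ Γ)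
    (f : β ↪ α) : ∀ σ, sign σ = 1 → σ ∈ Γ.comap (viaEmbeddingHom f) :=
  fun σ hσ => hΓ _ (by rw [sign_viaEmbeddingHom, hσ])

end Embedding

/-! ### Producing three-cycles, and from one three-cycle the alternating group -/

namespace AtMostThree

/-- Renaming the points lets cases that differ by a symmetry share one explicit computation. -/
theorem relabel {α : Type*} {Γ H : Subgroup (Perm α)} (h : AtMostThree Γ H) (σ : Perm α) :
    AtMostThree (Γ.comap (MulAut.conj σ).toMonoidHom) (H.comap (MulAut.conj σ).toMonoidHom) :=
  h.comap (MulAut.conj σ).injective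

theorem mem_relabel {α : Type*} {H : Subgroup (Perm α)} {σ τ : Perm α} :
    τ ∈ H.comap (MulAut.conj σ).toMonoidHom ↔ σ * τ * σ⁻¹ ∈ H :=
  Iff.rfl

theorem commute_viaEmbeddingHom {α β : Type*} (f : β ↪ α) (τ σ : Perm β)
    {x : Perm α} (hx : ∀ i, x (f i) = f (τ i)) (h : τ * σ = σ * τ) :
    x * viaEmbeddingHom f σ = viaEmbeddingHom f σ * x := by
  rw [← mul_inv_eq_iff_eq_mul, conj_viaEmbeddingHom_of_semiconj f τ σ x hx, h,
    mul_inv_cancel_right]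

variable {α : Type*} [Fintype α] [DecidableEq α] {Γ H : Subgroup (Perm α)}

theorem viaEmbeddingHom_mem {β : Type*} [Fintype β] [DecidableEq β]
    (hΓ : ∀ σ, sign σ = 1 → σ ∈ Γ) (f : β ↪ α) {σ : Perm β} (hσ : sign σ = 1) :
    viaEmbeddingHom f σ ∈ Γ :=
  alternatingGroup_le_comap hΓ f σ hσ

set_option maxRecDepth 4000 in
/-- If a nontrivial element of `H` fixes five points, then `H` contains a three-cycle. -/
theorem exists_isThreeCycle_of_fixed (h : AtMostThree Γ H) (hΓ : ∀ σ, sign σ = 1 → σ ∈ Γ)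
    {x : Perm α} (hx : x ∈ H) (hx1 : x ≠ 1) (f : Fin 5 ↪ α) (hf : ∀ i, x (f i) = f i) :
    ∃ σ ∈ H, σ.cycleType = {3} := by
  have key : ∀ σ : Perm (Fin 5), sign σ = 1 → σ ^ 5 = 1 → viaEmbeddingHom f σ ∈ H :=
    fun σ h1 h5 => h.mem_of_pow_prime_eq_one hx hx1 (viaEmbeddingHom_mem hΓ f h1)
      (commute_viaEmbeddingHom f 1 σ hf (by simp)) Nat.prime_five le_rfl
      (by rw [← map_pow, h5, map_one])
  -- Five-cycles on the five fixed points centralize `x` and hence lie in `H`; the product of these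
  -- two is a three-cycle.
  refine ⟨viaEmbeddingHom f (c[0, 1, 2, 3, 4] * c[0, 1, 4, 3, 2]), ?_, ?_⟩
  · rw [map_mul]
    exact mul_mem (key c[0, 1, 2, 3, 4] (by decide) (by decide))
      (key c[0, 1, 4, 3, 2] (by decide) (by decide))
  · rw [cycleType_viaEmbeddingHom]
    decide

/-- The lemmas on small degrees are transported along embeddings. -/
theorem exists_isThreeCycle_of_comap {β : Type*} [Fintype β] [DecidableEq β] {f : β ↪ α}
    (h : ∃ σ ∈ H.comap (viaEmbeddingHom f), σ.cycleType = {3}) : ∃ σ ∈ H, σ.cycleType = {3} := by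
  obtain ⟨σ, hσ, h3⟩ := h
  exact ⟨_, hσ, by rwa [cycleType_viaEmbeddingHom]⟩

theorem exists_isThreeCycle_of_cycleType_eq_two (h : AtMostThree Γ H)
    (hΓ : ∀ σ, sign σ = 1 → σ ∈ Γ) (hc : 7 ≤ Fintype.card α) {x : Perm α} (hx : x ∈ H)
    (hx2 : x.cycleType = {2}) : ∃ σ ∈ H, σ.cycleType = {3} := by
  obtain ⟨f, rfl⟩ := exists_viaEmbeddingHom_eq (τ := (c[0, 1] : Perm (Fin 7)))
    (hx2.trans (by decide)) (by simpa using hc)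
  refine exists_isThreeCycle_of_comap (f := f)
    ((h.comap_viaEmbedding f).exists_isThreeCycle_of_fixed (alternatingGroup_le_comap hΓ f)
      (x := c[0, 1]) hx (by decide) ⟨![2, 3, 4, 5, 6], by decide⟩ (by decide))

theorem exists_isThreeCycle_of_nine_le (h : AtMostThree Γ H)
    (hΓ : ∀ σ, sign σ = 1 → σ ∈ Γ) (hc : 9 ≤ Fintype.card α) {x : Perm α} (hx : x ∈ H)
    (hx2 : x.cycleType = {2, 2}) : ∃ σ ∈ H, σ.cycleType = {3} := by
  obtain ⟨f, rfl⟩ := exists_viaEmbeddingHom_eq (τ := (c[0, 1] * c[2, 3] : Perm (Fin 9)))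
    (hx2.trans (by decide)) (by simpa using hc)
  refine exists_isThreeCycle_of_comap (f := f)
    ((h.comap_viaEmbedding f).exists_isThreeCycle_of_fixed (alternatingGroup_le_comap hΓ f)
      (x := c[0, 1] * c[2, 3]) hx (by decide) ⟨![4, 5, 6, 7, 8], by decide⟩ (by decide))

theorem alternatingGroup_le_relabel (hΓ : ∀ σ, sign σ = 1 → σ ∈ Γ) (τ : Perm α) :
    ∀ σ, sign σ = 1 → σ ∈ Γ.comap (MulAut.conj τ).toMonoidHom :=
  fun σ hσ => hΓ _ (by simp [hσ])

section Seven

variable {Γ H : Subgroup (Perm (Fin 7))}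

/-- Both `(2 5 6)` and `(0 3)(1 4)` centralize `(0 1)(3 4)`, and they commute, so `three` and cubing
put one of them into `H`. Either way a conjugation yields `(2 3 4) ∈ H`, which conjugates `(0 1 2)`
to `(0 1 3)`. -/
theorem threeCycle_step_aux (h : AtMostThree Γ H) (hΓ : ∀ σ, sign σ = 1 → σ ∈ Γ)
    (hx : c[0, 1, 2] ∈ H) (ht : c[0, 1] * c[3, 4] ∈ H) (hv : c[3, 5] * c[4, 6] ∈ H) :
    c[0, 1, 3] ∈ H := by
  have key : c[2, 3, 4] ∈ H → c[0, 1, 3] ∈ H := fun hb =>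
    mem_of_eq (by decide) (mul_mem (mul_mem hb hx) (inv_mem hb))
  have hz : c[2, 5, 6] ∈ H → c[0, 1, 3] ∈ H := fun hz =>
    key (mem_of_eq (by decide) (mul_mem (mul_mem hv hz) hv))
  have hg : c[0, 3] * c[1, 4] ∈ H → c[0, 1, 3] ∈ H := fun hg =>
    key (mem_of_eq (by decide) (mul_mem (mul_mem hg hx) hg))
  rcases h.three ht (by decide) (z := c[2, 5, 6]) (t := c[0, 3] * c[1, 4])
    (hΓ _ (by decide)) (hΓ _ (by decide)) (by decide) (mem_of_eq (by decide) ht)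
    (mem_of_eq (by decide) ht) (mem_of_eq (by decide) ht) with hq | hq | hq | hq
  · exact hz hq
  · exact hg hq
  · exact hg (mem_of_eq (by decide) (pow_mem hq 3))
  · exact hg (mem_of_eq (by decide) (pow_mem hq 3))

/-- The group `A₄` on the points 3, 4, 5, 6 centralizes `(0 1 2)`, so its four-group lies in `H`.
Since `(3 4 5)` centralizes and `(0 1)(3 4)` inverts `(0 1 2)`, `three` adds `(3 4 5)` or a product
of `(0 1)` with a transposition on 3, 4, 5. In the first case a second `A₄`, on 0, 1, 2, 6, is
available. -/
theorem threeCycle_step (h : AtMostThree Γ H) (hΓ : ∀ σ, sign σ = 1 → σ ∈ Γ)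
    (hx : c[0, 1, 2] ∈ H) : c[0, 1, 3] ∈ H := by
  have hv : c[3, 4] * c[5, 6] ∈ H :=
    h.mem_of_tetrahedral hx (y := c[4, 5, 6]) (w := c[3, 5] * c[4, 6])
      (hΓ _ (by decide)) (hΓ _ (by decide)) (hΓ _ (by decide)) (by decide) (by decide)
  have hw : c[3, 5] * c[4, 6] ∈ H :=
    h.mem_of_tetrahedral hx (y := c[4, 5, 6]) (w := c[3, 6] * c[4, 5])
      (hΓ _ (by decide)) (hΓ _ (by decide)) (hΓ _ (by decide)) (by decide) (by decide)
  have hvw : c[3, 6] * c[4, 5] ∈ H := mem_of_eq (by decide) (mul_mem hv hw)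
  rcases h.three hx (by decide) (z := c[3, 4, 5]) (t := c[0, 1] * c[3, 4])
    (hΓ _ (by decide)) (hΓ _ (by decide)) (by decide) (mem_of_eq (by decide) hx)
    (mem_of_eq (by decide) hx) (mem_of_eq (by decide) (inv_mem hx))
    with hz | ht | ht | ht
  · have hu : c[0, 1] * c[2, 6] ∈ H :=
      h.mem_of_tetrahedral hz (y := c[1, 2, 6]) (w := c[0, 2] * c[1, 6])
        (hΓ _ (by decide)) (hΓ _ (by decide)) (hΓ _ (by decide)) (by decide) (by decide)
    exact mem_of_eq (by decide) (mul_mem (mul_mem hvw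
      (inv_mem (mul_mem (mul_mem hu hx) hu))) hvw)
  · exact h.threeCycle_step_aux hΓ hx ht hw
  · have := (h.relabel c[4, 5]).threeCycle_step_aux (alternatingGroup_le_relabel hΓ _)
      (mem_relabel.2 <| mem_of_eq (by decide) hx)
      (mem_relabel.2 <| mem_of_eq (by decide) ht)
      (mem_relabel.2 <| mem_of_eq (by decide) hv)
    exact mem_of_eq (by decide) (mem_relabel.1 this)
  · have := (h.relabel c[3, 5]).threeCycle_step_aux (alternatingGroup_le_relabel hΓ _)
      (mem_relabel.2 <| mem_of_eq (by decide) hx)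
      (mem_relabel.2 <| mem_of_eq (by decide) ht)
      (mem_relabel.2 <| mem_of_eq (by decide) hw)
    exact mem_of_eq (by decide) (mul_mem (mul_mem hw (mem_relabel.1 this)) hw)

end Seven

section Eight

variable {Γ H : Subgroup (Perm (Fin 8))}

/-- Centralizing copies of `A₄` enlarge `H` until it contains the fixed-point-free involution `(0
1)(2 3)(4 5)(6 7)` and its conjugates by `(4 5 6)`, its inverse and `(2 3 6)`. Coincidence of two of
the four resulting cosets yields a three-cycle. -/
theorem exists_isThreeCycle_eight_aux (h : AtMostThree Γ H) (hΓ : ∀ σ, sign σ = 1 → σ ∈ Γ)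
    (hx : c[0, 1] * c[2, 3] ∈ H) (ht : c[0, 1] * c[4, 5] ∈ H) : ∃ σ ∈ H, σ.cycleType = {3} := by
  have hv : c[4, 5] * c[6, 7] ∈ H :=
    h.mem_of_tetrahedral hx (y := c[5, 6, 7]) (w := c[4, 6] * c[5, 7])
      (hΓ _ (by decide)) (hΓ _ (by decide)) (hΓ _ (by decide)) (by decide) (by decide)
  have hw : c[4, 6] * c[5, 7] ∈ H :=
    h.mem_of_tetrahedral hx (y := c[5, 6, 7]) (w := c[4, 7] * c[5, 6])
      (hΓ _ (by decide)) (hΓ _ (by decide)) (hΓ _ (by decide)) (by decide) (by decide)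
  have hv' : c[2, 3] * c[6, 7] ∈ H :=
    h.mem_of_tetrahedral ht (y := c[3, 6, 7]) (w := c[2, 6] * c[3, 7])
      (hΓ _ (by decide)) (hΓ _ (by decide)) (hΓ _ (by decide)) (by decide) (by decide)
  have hw' : c[2, 6] * c[3, 7] ∈ H :=
    h.mem_of_tetrahedral ht (y := c[3, 6, 7]) (w := c[2, 7] * c[3, 6])
      (hΓ _ (by decide)) (hΓ _ (by decide)) (hΓ _ (by decide)) (by decide) (by decide)
  have hvw := mul_mem hv hw
  have three : c[4, 5, 6] ∈ H → ∃ σ ∈ H, σ.cycleType = {3} := fun hz => ⟨_, hz, by decide⟩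
  rcases h _ (mul_mem hx hv) (by decide) c[4, 5, 6] (hΓ _ (by decide)) c[4, 5, 6]⁻¹
    (hΓ _ (by decide)) c[2, 3, 6] (hΓ _ (by decide))
    (mem_of_eq (by decide) (mul_mem hx hw)) (mem_of_eq (by decide) (mul_mem hx hvw))
    (mem_of_eq (by decide) (mul_mem ht hw')) with hq | hq | hq | hq | hq | hq
  · exact three hq
  · exact three (inv_mem_iff.1 hq)
  · exact ⟨_, hq, by decide⟩
  · exact three (mem_of_eq (by decide) hq)
  · exact three (mem_of_eq (by decide) (mul_mem hq (inv_mem (mul_mem (mul_mem ht hq) ht))))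
  · exact three (mem_of_eq (by decide) (mul_mem (mul_mem (mul_mem ht hq) ht) (inv_mem hq)))

theorem exists_isThreeCycle_eight (h : AtMostThree Γ H) (hΓ : ∀ σ, sign σ = 1 → σ ∈ Γ)
    (hx : c[0, 1] * c[2, 3] ∈ H) : ∃ σ ∈ H, σ.cycleType = {3} := by
  have conj : ∀ τ : Perm (Fin 8),
      (∃ σ ∈ H.comap (MulAut.conj τ).toMonoidHom, σ.cycleType = {3}) → ∃ σ ∈ H, σ.cycleType = {3} := by
    rintro τ ⟨σ, hσ, h3⟩
    exact ⟨_, hσ, by simpa using h3⟩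
  rcases h.three hx (by decide) (z := c[4, 5, 6]) (t := c[0, 1] * c[4, 5])
    (hΓ _ (by decide)) (hΓ _ (by decide)) (by decide) (mem_of_eq (by decide) hx)
    (mem_of_eq (by decide) hx) (mem_of_eq (by decide) hx) with hq | hq | hq | hq
  · exact ⟨_, hq, by decide⟩
  · exact h.exists_isThreeCycle_eight_aux hΓ hx hq
  · exact conj c[5, 6] ((h.relabel _).exists_isThreeCycle_eight_aux
      (alternatingGroup_le_relabel hΓ _) (mem_relabel.2 <| mem_of_eq (by decide) hx)
      (mem_relabel.2 <| mem_of_eq (by decide) hq))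
  · exact conj c[4, 6] ((h.relabel _).exists_isThreeCycle_eight_aux
      (alternatingGroup_le_relabel hΓ _) (mem_relabel.2 <| mem_of_eq (by decide) hx)
      (mem_relabel.2 <| mem_of_eq (by decide) hq))

end Eight

/-- In the symmetric group of degree seven, double transpositions produce three-cycles. -/
theorem exists_isThreeCycle_symmetric_seven {H : Subgroup (Perm (Fin 7))} (h : AtMostThree ⊤ H)
    (hx : c[0, 1] * c[2, 3] ∈ H) : ∃ σ ∈ H, σ.cycleType = {3} := by
  have swap : ∀ σ ∈ H, σ.cycleType = {2} → ∃ σ ∈ H, σ.cycleType = {3} := fun σ hσ h2 =>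
    h.exists_isThreeCycle_of_cycleType_eq_two (fun _ _ => Subgroup.mem_top _) (by simp) hσ h2
  rcases h.three hx (by decide) (z := c[4, 5, 6]) (t := c[4, 5])
    (Subgroup.mem_top _) (Subgroup.mem_top _) (by decide) (mem_of_eq (by decide) hx)
    (mem_of_eq (by decide) hx) (mem_of_eq (by decide) hx) with hq | hq | hq | hq
  · exact ⟨_, hq, by decide⟩
  all_goals exact swap _ hq (by decide)

theorem viaEmbeddingHom_swap {α β : Type*} [DecidableEq α] [DecidableEq β] (f : β ↪ α) (i j : β) :
    viaEmbeddingHom f (swap i j) = swap (f i) (f j) := by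
  ext x
  rw [viaEmbeddingHom_apply]
  by_cases hx : x ∈ Set.range f
  · obtain ⟨k, rfl⟩ := hx
    rw [viaEmbedding_apply, f.swap_apply]
  · rw [viaEmbedding_apply_of_notMem _ _ _ hx, swap_apply_of_ne_of_ne]
    · rintro rfl; exact hx ⟨i, rfl⟩
    · rintro rfl; exact hx ⟨j, rfl⟩

/-- Any further point `d` lies with the three-cycle in a seven-element subset, where
`threeCycle_step` replaces the third point of the cycle by `d`. -/
theorem swap_mul_swap_mem (h : AtMostThree Γ H) (hΓ : ∀ σ, sign σ = 1 → σ ∈ Γ)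
    (hc : 7 ≤ Fintype.card α) {σ : Perm α} (hσ : σ ∈ H) (h3 : σ.cycleType = {3}) :
    ∃ a b, a ≠ b ∧ ∀ d, d ≠ a → swap a b * swap a d ∈ H := by
  obtain ⟨f, rfl⟩ := exists_viaEmbeddingHom_eq (τ := (c[0, 1, 2] : Perm (Fin 3)))
    (h3.trans (by decide)) (by simp; omega)
  refine ⟨f 1, f 0, by simp, fun d hd => ?_⟩
  have e : (c[0, 1, 2] : Perm (Fin 3)) = swap 1 0 * swap 1 2 := by decide
  rw [e, map_mul, viaEmbeddingHom_swap, viaEmbeddingHom_swap] at hσ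
  by_cases hd0 : d = f 0
  · simp [hd0]
  by_cases hd2 : d = f 2
  · rwa [hd2]
  obtain ⟨g, hg⟩ := Fin.Embedding.restrictSurjective_of_le_natCard (α := α) (m := 4) (n := 7)
    (by norm_num) (by simpa using hc) ⟨![f 0, f 1, f 2, d], by
      intro i j
      fin_cases i <;> fin_cases j <;> simp [Ne.symm hd, Ne.symm hd0, Ne.symm hd2, hd, hd0, hd2]⟩
  have g0 : g 0 = f 0 := DFunLike.congr_fun hg 0
  have g1 : g 1 = f 1 := DFunLike.congr_fun hg 1
  have g2 : g 2 = f 2 := DFunLike.congr_fun hg 2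
  have g3 : g 3 = d := DFunLike.congr_fun hg 3
  have e2 : (c[0, 1, 2] : Perm (Fin 7)) = swap 1 0 * swap 1 2 := by decide
  have e3 : (c[0, 1, 3] : Perm (Fin 7)) = swap 1 0 * swap 1 3 := by decide
  have := (h.comap_viaEmbedding g).threeCycle_step (alternatingGroup_le_comap hΓ g)
    (by rw [Subgroup.mem_comap, e2, map_mul, viaEmbeddingHom_swap, viaEmbeddingHom_swap, g0, g1,
      g2]; exact hσ)
  rwa [Subgroup.mem_comap, e3, map_mul, viaEmbeddingHom_swap, viaEmbeddingHom_swap, g0, g1, g3]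
    at this

/-- Every three-cycle is an even product of transpositions through `a`, and consecutive pairs of
these lie in `K`. -/
theorem alternatingGroup_le_of_swap_mul_swap_mem {K : Subgroup (Perm α)} {a b : α} (hab : a ≠ b)
    (hK : ∀ d, d ≠ a → swap a b * swap a d ∈ K) : alternatingGroup α ≤ K := by
  have h2 : ∀ d e, d ≠ a → e ≠ a → swap a d * swap a e ∈ K := fun d e hd he => by
    refine mem_of_eq ?_ (mul_mem (inv_mem (hK d hd)) (hK e he))
    simp [mul_assoc]
  have h3 : ∀ d e, d ≠ a → e ≠ a → d ≠ e → swap d e = swap a d * swap a e * swap a d :=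
    fun d e hd he hde => by
      rw [swap_comm a e, swap_mul_swap_mul_swap he hde.symm]
  rw [← closure_three_cycles_eq_alternating, Subgroup.closure_le]
  intro σ hσ
  have hσ' : σ.IsThreeCycle := hσ
  obtain ⟨x, hx, hxa⟩ : ∃ x ∈ σ.support, a ∈ σ.support → x = a := by
    by_cases ha : a ∈ σ.support
    · exact ⟨a, ha, fun _ => rfl⟩
    · obtain ⟨x, hx⟩ := hσ'.isCycle.nonempty_support
      exact ⟨x, hx, fun h => absurd h ha⟩
  have hn := hσ'.nodup_iff_mem_support.2 hx
  simp only [List.nodup_cons, List.mem_cons, List.not_mem_nil, or_false, not_or, not_false_eq_true,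
    List.nodup_nil, and_true] at hn
  obtain ⟨⟨hxy, hxz⟩, hyz⟩ := hn
  have hs := hσ'.eq_swap_mul_swap_iff_mem_support.2 hx
  by_cases hax : x = a
  · subst hax
    rw [SetLike.mem_coe, hs, h3 _ _ (Ne.symm hxy) (Ne.symm hxz) hyz]
    refine mem_of_eq ?_ (h2 _ _ (Ne.symm hxz) (Ne.symm hxy))
    simp [mul_assoc]
  · have hy : σ x ≠ a := fun h => hax (hxa (h ▸ apply_mem_support.2 hx))
    have hz : σ (σ x) ≠ a :=
      fun h => hax (hxa (h ▸ apply_mem_support.2 (apply_mem_support.2 hx)))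
    rw [SetLike.mem_coe, hs, h3 _ _ hax hy hxy, h3 _ _ hy hz hyz]
    exact mem_of_eq (by simp only [mul_assoc])
      (mul_mem (mul_mem (h2 _ _ hax hy) (h2 _ _ hax hy)) (h2 _ _ hz hy))

theorem alternatingGroup_le_of_mem (h : AtMostThree Γ H) (hΓ : ∀ σ, sign σ = 1 → σ ∈ Γ)
    (hc : 7 ≤ Fintype.card α) {σ : Perm α} (hσ : σ ∈ H) (h3 : σ.cycleType = {3}) :
    alternatingGroup α ≤ H := by
  obtain ⟨a, b, hab, hK⟩ := h.swap_mul_swap_mem hΓ hc hσ h3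
  exact alternatingGroup_le_of_swap_mul_swap_mem hab hK

theorem alternatingGroup_le_of_eight_le (h : AtMostThree Γ H) (hΓ : ∀ σ, sign σ = 1 → σ ∈ Γ)
    (hc : 8 ≤ Fintype.card α) {σ : Perm α} (hσ : σ ∈ H) (h2 : σ.cycleType = {2, 2}) :
    alternatingGroup α ≤ H := by
  obtain ⟨τ, hτ, h3⟩ : ∃ τ ∈ H, τ.cycleType = {3} := by
    rcases hc.eq_or_lt with hc | hc
    · obtain ⟨f, rfl⟩ := exists_viaEmbeddingHom_eq (τ := (c[0, 1] * c[2, 3] : Perm (Fin 8)))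
        (h2.trans (by decide)) (by simpa using hc.le)
      exact exists_isThreeCycle_of_comap ((h.comap_viaEmbedding f).exists_isThreeCycle_eight
        (alternatingGroup_le_comap hΓ f) hσ)
    · exact h.exists_isThreeCycle_of_nine_le hΓ hc hσ h2
  exact h.alternatingGroup_le_of_mem hΓ (by omega) hτ h3

end AtMostThree

/-! ### Elements of prime order in `H` -/

namespace AtMostThree

variable {α : Type*} [Fintype α] [DecidableEq α] {Γ H : Subgroup (Perm α)}

/-- With at least three transpositions in `x`, the products of two among three of them form, with 1,
a Klein four-group centralizing `x`, which meets `H`. -/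
theorem exists_cycleType_of_orderOf_eq_two (h : AtMostThree Γ H)
    (hΓ : ∀ σ, sign σ = 1 → σ ∈ Γ) {x : Perm α} (hx : x ∈ H) (h2 : orderOf x = 2) :
    ∃ σ ∈ H, σ.cycleType = {2} ∨ σ.cycleType = {2, 2} := by
  obtain ⟨k, hk⟩ := cycleType_prime_order (σ := x) (h2 ▸ Nat.prime_two)
  rw [h2] at hk
  match k with
  | 0 => exact ⟨x, hx, Or.inl (by simpa using hk)⟩
  | 1 => exact ⟨x, hx, Or.inr (by simpa using hk)⟩
  | k + 2 =>
    have hs : x.support.card = 2 * (k + 3) := by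
      rw [← sum_cycleType, hk]; simp; ring
    have hxx : ∀ a, x (x a) = a := fun a => by
      have : (x ^ 2) a = a := by rw [← h2, pow_orderOf_eq_one]; rfl
      simpa [sq] using this
    obtain ⟨a, ha⟩ : x.support.Nonempty := Finset.card_pos.1 (by omega)
    obtain ⟨b, hb, hb'⟩ : ∃ b ∈ x.support, b ∉ ({a, x a} : Finset α) :=
      Finset.exists_mem_notMem_of_card_lt_card
        (by rw [hs]; exact Finset.card_le_two.trans_lt (by omega))
    obtain ⟨c, hc, hc'⟩ : ∃ c ∈ x.support, c ∉ ({a, x a, b, x b} : Finset α) :=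
      Finset.exists_mem_notMem_of_card_lt_card
        (by rw [hs]; exact Finset.card_le_four.trans_lt (by omega))
    simp only [Finset.mem_insert, Finset.mem_singleton, not_or, mem_support] at ha hb hb' hc hc'
    let f : Fin 6 ↪ α := ⟨![a, x a, b, x b, c, x c], by
      have i1 : x b ≠ a := fun h => hb'.2 (by rw [← h, hxx])
      have i2 : x b ≠ x a := fun h => hb'.1 (x.injective h)
      have i3 : x c ≠ a := fun h => hc'.2.1 (by rw [← h, hxx])
      have i4 : x c ≠ x a := fun h => hc'.1 (x.injective h)
      have i5 : x c ≠ b := fun h => hc'.2.2.2 (by rw [← h, hxx])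
      have i6 : x c ≠ x b := fun h => hc'.2.2.1 (x.injective h)
      rw [← List.nodup_ofFn]
      simp
      grind⟩
    have hf : ∀ i, x (f i) = f ((c[0, 1] * c[2, 3] * c[4, 5] : Perm (Fin 6)) i) := by
      intro i
      fin_cases i
      · rfl
      · exact hxx a
      · rfl
      · exact hxx b
      · rfl
      · exact hxx c
    have hx1 : x ≠ 1 := by rintro rfl; simp at h2
    have key := h.klein hx hx1 (a := viaEmbeddingHom f (c[0, 1] * c[2, 3]))
      (b := viaEmbeddingHom f (c[2, 3] * c[4, 5]))
      (viaEmbeddingHom_mem hΓ f (by decide)) (viaEmbeddingHom_mem hΓ f (by decide))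
      (commute_viaEmbeddingHom f _ _ hf (by decide)) (commute_viaEmbeddingHom f _ _ hf (by decide))
      (by rw [← map_mul, ← map_mul]; congr 1; decide)
      (by rw [← map_mul, ← map_one (viaEmbeddingHom f)]; congr 1; decide)
    rw [← map_mul] at key
    rcases key with hq | hq | hq
    all_goals exact ⟨_, hq, Or.inr (by rw [cycleType_viaEmbeddingHom]; decide)⟩

/-- If `x` has two three-cycles, `three` applied to them gives a three-cycle in `H` or an element `y
∈ H` of type `{3, 3}`. The involution `(0 1)(3 4)` inverts or swaps compatibly the cycles of `y`, so
a second use of `three` finishes. -/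
theorem exists_cycleType_of_orderOf_eq_three (h : AtMostThree Γ H)
    (hΓ : ∀ σ, sign σ = 1 → σ ∈ Γ) {x : Perm α} (hx : x ∈ H) (h3 : orderOf x = 3) :
    ∃ σ ∈ H, σ.cycleType = {3} ∨ σ.cycleType = {2, 2} := by
  obtain ⟨k, hk⟩ := cycleType_prime_order (σ := x) (h3 ▸ Nat.prime_three)
  rw [h3] at hk
  match k with
  | 0 => exact ⟨x, hx, Or.inl (by simpa using hk)⟩
  | k + 1 =>
    have hs : x.support.card = 3 * (k + 2) := by
      rw [← sum_cycleType, hk]; simp; ring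
    have hxx : ∀ a, x (x (x a)) = a := fun a => by
      have : (x ^ 3) a = a := by rw [← h3, pow_orderOf_eq_one]; rfl
      simpa [pow_succ] using this
    obtain ⟨a, ha⟩ : x.support.Nonempty := Finset.card_pos.1 (by omega)
    obtain ⟨b, hb, hb'⟩ : ∃ b ∈ x.support, b ∉ ({a, x a, x (x a)} : Finset α) :=
      Finset.exists_mem_notMem_of_card_lt_card
        (by rw [hs]; exact Finset.card_le_three.trans_lt (by omega))
    simp only [Finset.mem_insert, Finset.mem_singleton, not_or, mem_support] at ha hb hb'
    let f : Fin 6 ↪ α := ⟨![a, x a, x (x a), b, x b, x (x b)], by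
      have i0 : x (x a) ≠ a := fun h => ha (by have := congrArg x h; rw [hxx] at this; exact this.symm)
      have j0 : x (x b) ≠ b := fun h => hb (by have := congrArg x h; rw [hxx] at this; exact this.symm)
      have i1 : x b ≠ a := fun h => hb'.2.2 (by rw [← h, hxx])
      have i2 : x b ≠ x a := fun h => hb'.1 (x.injective h)
      have i3 : x b ≠ x (x a) := fun h => hb'.2.1 (x.injective h)
      have i4 : x (x b) ≠ a := fun h => hb'.2.1 (by rw [← h, hxx])
      have i5 : x (x b) ≠ x a := fun h => i1 (x.injective h)
      have i6 : x (x b) ≠ x (x a) := fun h => i2 (x.injective h)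
      rw [← List.nodup_ofFn]
      simp
      grind⟩
    have hf : ∀ i, x (f i) = f ((c[0, 1, 2] * c[3, 4, 5] : Perm (Fin 6)) i) := by
      intro i
      fin_cases i
      · rfl
      · rfl
      · exact hxx a
      · rfl
      · rfl
      · exact hxx b
    have hx1 : x ≠ 1 := by rintro rfl; simp at h3
    have hc := fun σ => commute_viaEmbeddingHom f _ σ hf
    have hc1 := hc c[0, 1, 2] (by decide)
    have hc2 := hc c[3, 4, 5] (by decide)
    have hK := h.comap_viaEmbedding f
    have hΓ' := alternatingGroup_le_comap hΓ f
    -- an element of `H` with two nontrivial cycles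
    have step : ∀ y : Perm (Fin 6), y = c[0, 1, 2] * c[3, 4, 5] ∨ y = c[0, 2, 1] * c[3, 4, 5] →
        y ∈ H.comap (viaEmbeddingHom f) → ∃ σ ∈ H, σ.cycleType = {3} ∨ σ.cycleType = {2, 2} := by
      intro y hy hyH
      have hw : ∃ σ ∈ H.comap (viaEmbeddingHom f), σ.cycleType = {3} ∨ σ.cycleType = {2, 2} := by
        rcases hK.three hyH (z := c[0, 1, 2]) (t := c[0, 1] * c[3, 4])
          (by rcases hy with rfl | rfl <;> decide)
          (hΓ' _ (by decide)) (hΓ' _ (by decide)) (by decide)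
          (mem_of_eq (by rcases hy with rfl | rfl <;> decide) hyH)
          (mem_of_eq (by rcases hy with rfl | rfl <;> decide) hyH)
          (mem_of_eq (by rcases hy with rfl | rfl <;> decide) (inv_mem hyH)) with hq | hq | hq | hq
        · exact ⟨_, hq, Or.inl (by decide)⟩
        all_goals exact ⟨_, hq, Or.inr (by decide)⟩
      obtain ⟨σ, hσ, h'⟩ := hw
      exact ⟨_, hσ, by rwa [cycleType_viaEmbeddingHom]⟩
    have key := h.three hx hx1 (z := viaEmbeddingHom f c[0, 1, 2])
      (t := viaEmbeddingHom f c[3, 4, 5])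
      (viaEmbeddingHom_mem hΓ f (by decide)) (viaEmbeddingHom_mem hΓ f (by decide))
      (by rw [← map_pow, ← map_one (viaEmbeddingHom f)]; congr 1; decide)
      (by rw [mul_assoc, hc1, inv_mul_cancel_left]; exact hx)
      (by rw [← hc1, mul_inv_cancel_right]; exact hx)
      (by rw [mul_assoc, hc2, inv_mul_cancel_left]; exact hx)
    rw [← map_mul, ← map_inv, ← map_mul] at key
    rcases key with hq | hq | hq | hq
    · exact ⟨_, hq, Or.inl (by rw [cycleType_viaEmbeddingHom]; decide)⟩
    · exact ⟨_, hq, Or.inl (by rw [cycleType_viaEmbeddingHom]; decide)⟩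
    · exact step _ (Or.inl rfl) hq
    · exact step _ (Or.inr (by decide)) hq

/-- The embedding of `ZMod p` onto a nontrivial orbit of an element of order `p`. -/
theorem exists_zmod_embedding {p : ℕ} [hp : Fact p.Prime] {x : Perm α} (hx : orderOf x = p) :
    ∃ f : ZMod p ↪ α, ∀ i, x (f i) = f (i + 1) := by
  have hx1 : x ≠ 1 := by rintro rfl; rw [orderOf_one] at hx; exact hp.out.one_lt.ne hx
  obtain ⟨a, ha⟩ : ∃ a, x a ≠ a := by
    by_contra! hc
    exact hx1 (Equiv.ext hc)
  have hfix : ∀ d, 0 < d → d < p → (x ^ d) a ≠ a := fun d hd hdp hda => by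
    have hcop : (orderOf x).Coprime d := by
      rw [hx]; exact Nat.coprime_of_lt_prime hd.ne' hdp hp.out
    obtain ⟨m, hm⟩ := exists_pow_eq_self_of_coprime hcop.symm
    refine ha ?_
    conv_lhs => rw [← hm]
    exact pow_apply_eq_self_of_apply_eq_self hda m
  have hinj : ∀ i j, i < j → j < p → (x ^ i) a ≠ (x ^ j) a := fun i j hij hj he => by
    refine hfix (j - i) (by omega) (by omega) ?_
    apply (x ^ i).injective
    rw [← mul_apply, ← pow_add, Nat.add_sub_cancel' hij.le, he]
  refine ⟨⟨fun i => (x ^ i.val) a, fun i j hij => ?_⟩, fun i => ?_⟩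
  · rcases lt_trichotomy i.val j.val with hlt | heq | hlt
    · exact absurd hij (hinj _ _ hlt (ZMod.val_lt j))
    · exact ZMod.val_injective p heq
    · exact absurd hij.symm (hinj _ _ hlt (ZMod.val_lt i))
  · change x ((x ^ i.val) a) = (x ^ (i + 1).val) a
    rw [← mul_apply, ← pow_succ']
    congr 1
    rw [pow_eq_pow_iff_modEq, hx, ← ZMod.natCast_eq_natCast_iff]
    simp

theorem addRight_one_pow_val_apply {n : ℕ} [NeZero n] (k i : ZMod n) :
    (Equiv.addRight (1 : ZMod n) ^ k.val) i = i + k := by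
  simp

/-- A single `p`-cycle of `x` is an even permutation of order `p ≥ 5` centralizing `x`, so it lies
in `H`. -/
theorem exists_viaEmbeddingHom_addRight_mem (h : AtMostThree Γ H)
    (hΓ : ∀ σ, sign σ = 1 → σ ∈ Γ) {p : ℕ} [hp : Fact p.Prime] (hp5 : 5 ≤ p) {x : Perm α}
    (hxH : x ∈ H) (hx : orderOf x = p) :
    ∃ f : ZMod p ↪ α, viaEmbeddingHom f (Equiv.addRight 1) ∈ H := by
  obtain ⟨f, hf⟩ := exists_zmod_embedding hx
  have hx1 : x ≠ 1 := by rintro rfl; rw [orderOf_one] at hx; exact hp.out.one_lt.ne hx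
  have hpow : (Equiv.addRight (1 : ZMod p)) ^ p = 1 := by
    ext i
    simp
  refine ⟨f, h.mem_of_pow_prime_eq_one hxH hx1 (viaEmbeddingHom_mem hΓ f ?_)
    (commute_viaEmbeddingHom f (Equiv.addRight 1) _ hf rfl) hp.out hp5
    (by rw [← map_pow, hpow, map_one])⟩
  have : sign (Equiv.addRight (1 : ZMod p)) ^ p = 1 := by rw [← map_pow, hpow, map_one]
  have hodd : Odd p := hp.out.odd_of_ne_two (by omega)
  rcases Int.units_eq_one_or (sign (Equiv.addRight (1 : ZMod p))) with h1 | h1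
  · exact h1
  · rw [h1, hodd.neg_one_pow] at this
    exact absurd this (by decide)

set_option maxRecDepth 4000 in
-- Doubling modulo 5 normalizes the five-cycle. It is odd, so the transposition `(5 6)` is attached;
-- the square of the result is a double transposition and lies in `H` in all cases of `pow_mem_or`.
theorem exists_cycleType_of_orderOf_eq_five (h : AtMostThree Γ H)
    (hΓ : ∀ σ, sign σ = 1 → σ ∈ Γ) (hc : 7 ≤ Fintype.card α) {x : Perm α} (hxH : x ∈ H)
    (hx : orderOf x = 5) : ∃ σ ∈ H, σ.cycleType = {2, 2} := by
  have e : (Equiv.addRight (1 : ZMod 5)).cycleType = {5} := by decide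
  have : Fact (Nat.Prime 5) := ⟨Nat.prime_five⟩
  obtain ⟨f, hf⟩ := h.exists_viaEmbeddingHom_addRight_mem hΓ le_rfl hxH hx
  obtain ⟨g, hg⟩ := exists_viaEmbeddingHom_eq (τ := (c[0, 1, 2, 3, 4] : Perm (Fin 7)))
    (σ := viaEmbeddingHom f (Equiv.addRight 1))
    (by rw [cycleType_viaEmbeddingHom]; exact e.trans (by decide)) (by simpa using hc)
  rw [← hg] at hf
  have hu : (c[1, 2, 4, 3] * c[5, 6]) ^ 2 ∈ H.comap (viaEmbeddingHom g) := by
    rcases (h.comap_viaEmbedding g).pow_mem_or (x := c[0, 1, 2, 3, 4])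
      (u := c[1, 2, 4, 3] * c[5, 6]) hf (by decide)
      (alternatingGroup_le_comap hΓ g _ (by decide)) 3 (by decide) with hq | hq | hq
    · exact pow_mem hq 2
    · exact hq
    · exact mem_of_eq (by decide) (pow_mem hq 2)
  exact ⟨_, hu, by rw [cycleType_viaEmbeddingHom]; decide⟩

set_option maxRecDepth 4000 in
-- Multiplication by 3 modulo 7 is an odd six-cycle normalizing the seven-cycle. Two spare points,
-- hence degree nine, are needed to make it even.
theorem exists_mem_pow_eq_one_of_seven (h : AtMostThree Γ H)
    (hΓ : ∀ σ, sign σ = 1 → σ ∈ Γ) (hc : 9 ≤ Fintype.card α) {x : Perm α} (hxH : x ∈ H)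
    (hx : orderOf x = 7) : ∃ σ ∈ H, σ ≠ 1 ∧ σ ^ 6 = 1 := by
  have e : (Equiv.addRight (1 : ZMod 7)).cycleType = {7} := by decide
  have : Fact (Nat.Prime 7) := ⟨by norm_num⟩
  obtain ⟨f, hf⟩ := h.exists_viaEmbeddingHom_addRight_mem hΓ (by norm_num) hxH hx
  obtain ⟨g, hg⟩ := exists_viaEmbeddingHom_eq (τ := (c[0, 1, 2, 3, 4, 5, 6] : Perm (Fin 9)))
    (σ := viaEmbeddingHom f (Equiv.addRight 1))
    (by rw [cycleType_viaEmbeddingHom]; exact e.trans (by decide)) (by simpa using hc)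
  rw [← hg] at hf
  have key : ∀ σ : Perm (Fin 9), σ ≠ 1 ∧ σ ^ 6 = 1 → σ ∈ H.comap (viaEmbeddingHom g) →
      ∃ σ ∈ H, σ ≠ 1 ∧ σ ^ 6 = 1 := fun σ h1 hσ =>
    ⟨_, hσ, fun h0 => h1.1 (viaEmbeddingHom_injective g (by rw [h0, map_one])), by
      rw [← map_pow, h1.2, map_one]⟩
  rcases (h.comap_viaEmbedding g).pow_mem_or (x := c[0, 1, 2, 3, 4, 5, 6])
    (u := c[1, 3, 2, 6, 4, 5] * c[7, 8]) hf (by decide)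
    (alternatingGroup_le_comap hΓ g _ (by decide)) 5 (by decide) with hq | hq | hq
  all_goals exact key _ (by decide) hq

/-- Multiplication by the square of a primitive root is an even permutation normalizing the
`p`-cycle. Its order is `(p - 1) / 2 > 3`, so its first three powers are nontrivial. -/
theorem exists_mem_pow_eq_one_of_eleven_le (h : AtMostThree Γ H)
    (hΓ : ∀ σ, sign σ = 1 → σ ∈ Γ) {p : ℕ} [hp : Fact p.Prime] (hp7 : 7 < p) {x : Perm α}
    (hxH : x ∈ H) (hx : orderOf x = p) : ∃ σ ∈ H, σ ≠ 1 ∧ σ ^ (p - 1) = 1 := by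
  obtain ⟨f, hf⟩ := h.exists_viaEmbeddingHom_addRight_mem hΓ (by omega) hxH hx
  obtain ⟨v, hv⟩ := IsCyclic.exists_generator (α := (ZMod p)ˣ)
  have ho : orderOf v = p - 1 := by
    rw [orderOf_eq_card_of_forall_mem_zpowers hv, Nat.card_eq_fintype_card, ZMod.card_units]
  -- multiplication by a unit
  let μ : (ZMod p)ˣ →* Perm (ZMod p) := MulAction.toPermHom (ZMod p)ˣ (ZMod p)
  have hμ : ∀ (w : (ZMod p)ˣ) i, μ w i = w * i := fun w i => rfl
  have hμ1 : ∀ w : (ZMod p)ˣ, μ w = 1 → w = 1 := fun w hw => by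
    have := hμ w 1
    rw [hw] at this
    ext
    simpa using this.symm
  have hconj : ∀ w : (ZMod p)ˣ, μ w⁻¹ * Equiv.addRight 1 * μ w =
      (Equiv.addRight (1 : ZMod p)) ^ (w⁻¹ : (ZMod p)ˣ).val.val := by
    intro w
    ext i
    rw [mul_apply, mul_apply, hμ, hμ, coe_addRight, mul_add, Units.inv_mul_cancel_left,
      addRight_one_pow_val_apply, mul_one]
  have hs : sign (μ (v ^ 2)) = 1 := by
    rw [map_pow, map_pow, Int.units_sq]
  have hne : (Equiv.addRight (1 : ZMod p)) ≠ 1 := fun h0 => by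
    have := Equiv.congr_fun h0 0
    simp at this
  have key : ∀ i, 0 < i → i ≤ 3 → μ (v ^ 2) ^ i ∈ H.comap (viaEmbeddingHom f) →
      ∃ σ ∈ H, σ ≠ 1 ∧ σ ^ (p - 1) = 1 := fun i hi hi3 hm => by
    refine ⟨_, hm, fun h0 => ?_, ?_⟩
    · have h1 := hμ1 ((v ^ 2) ^ i) (viaEmbeddingHom_injective f (by rw [map_pow, h0, map_one]))
      rw [← pow_mul] at h1
      have h2 := Nat.le_of_dvd (by omega) (orderOf_dvd_of_pow_eq_one h1)
      have hodd := hp.out.odd_of_ne_two (by omega)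
      rw [ho] at h2
      have h8 : p ≠ 8 := by rintro rfl; revert hodd; decide
      have h9 : p ≠ 9 := by rintro rfl; exact absurd hp.out (by norm_num)
      omega
    · have hv1 : (v ^ 2) ^ (p - 1) = 1 := by rw [← ho, pow_right_comm, pow_orderOf_eq_one, one_pow]
      rw [← map_pow, pow_right_comm, ← map_pow μ, hv1, map_one, one_pow, map_one]
  rcases (h.comap_viaEmbedding f).pow_mem_or (u := μ (v ^ 2)) hf hne
    (alternatingGroup_le_comap hΓ f _ hs) _ (by rw [← map_inv]; exact hconj _) with hq | hq | hq
  · exact key 1 (by omega) (by omega) (by simpa using hq)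
  · exact key 2 (by omega) (by omega) hq
  · exact key 3 (by omega) (by omega) hq

/-- Nontrivial stabilizers contain one of three short elements, or have order `7`. -/
theorem exists_cycleType (h : AtMostThree Γ H) (hΓ : ∀ σ, sign σ = 1 → σ ∈ Γ)
    (hc : 7 ≤ Fintype.card α) (hH : H ≠ ⊥) :
    (∃ σ ∈ H, σ.cycleType = {2} ∨ σ.cycleType = {3} ∨ σ.cycleType = {2, 2}) ∨
      Fintype.card α ≤ 8 ∧ Nat.card H = 7 := by
  -- For `p > 7`, and for `p = 7` in degree at least nine, the normalizer of a `p`-cycle would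
  -- supply an element of `H` with a smaller prime in its order, against minimality.
  set p := (Nat.card H).minFac with hp
  have hcard : Nat.card H ≠ 1 := by rwa [Ne, Subgroup.card_eq_one]
  have hpp : p.Prime := Nat.minFac_prime hcard
  have : Fact p.Prime := ⟨hpp⟩
  have hmin : ∀ σ ∈ H, σ ≠ 1 → ∀ m, 0 < m → σ ^ m = 1 → p ≤ m := fun σ hσ h1 m hm hσm => by
    have hd : orderOf σ ∣ Nat.card H := by
      have := orderOf_dvd_natCard (⟨σ, hσ⟩ : H)
      rwa [Subgroup.orderOf_mk] at this
    have ho : orderOf σ ≠ 1 := by rwa [Ne, orderOf_eq_one_iff]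
    calc p ≤ (orderOf σ).minFac := Nat.minFac_le_of_dvd (Nat.minFac_prime ho).two_le
            ((Nat.minFac_dvd _).trans hd)
      _ ≤ orderOf σ := Nat.minFac_le (orderOf_pos σ)
      _ ≤ m := Nat.le_of_dvd hm (orderOf_dvd_of_pow_eq_one hσm)
  obtain ⟨⟨x, hx⟩, hxp⟩ := exists_prime_orderOf_dvd_card' (G := H) p (Nat.minFac_dvd _)
  rw [Subgroup.orderOf_mk] at hxp
  have h4 : p ≠ 4 := by intro h; rw [h] at hpp; exact absurd hpp (by norm_num)
  have h6 : p ≠ 6 := by intro h; rw [h] at hpp; exact absurd hpp (by norm_num)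
  have := hpp.two_le
  rcases (by omega : p = 2 ∨ p = 3 ∨ p = 5 ∨ p = 7 ∨ 7 < p) with h2 | h3 | h5 | h7 | h7
  · obtain ⟨σ, hσ, ht⟩ := h.exists_cycleType_of_orderOf_eq_two hΓ hx (hxp.trans h2)
    exact Or.inl ⟨σ, hσ, by tauto⟩
  · obtain ⟨σ, hσ, ht⟩ := h.exists_cycleType_of_orderOf_eq_three hΓ hx (hxp.trans h3)
    exact Or.inl ⟨σ, hσ, by tauto⟩
  · obtain ⟨σ, hσ, ht⟩ := h.exists_cycleType_of_orderOf_eq_five hΓ hc hx (hxp.trans h5)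
    exact Or.inl ⟨σ, hσ, by tauto⟩
  · right
    have hc8 : Fintype.card α ≤ 8 := by
      by_contra! hc9
      obtain ⟨σ, hσ, h1, ht⟩ := h.exists_mem_pow_eq_one_of_seven hΓ hc9 hx (hxp.trans h7)
      have := hmin σ hσ h1 6 (by norm_num) ht
      omega
    refine ⟨hc8, ?_⟩
    have hdvd : Nat.card H ∣ Nat.factorial 8 := by
      refine (Subgroup.card_subgroup_dvd_card H).trans ?_
      rw [Nat.card_eq_fintype_card, Fintype.card_perm]
      exact Nat.factorial_dvd_factorial hc8
    -- Here `5760 = 8! / 7` involves only the primes 2, 3 and 5.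
    have hcop : (Nat.card H).Coprime 5760 := by
      refine Nat.coprime_of_dvd fun k hk hkH hk5 => ?_
      have h1 : p ≤ k := Nat.minFac_le_of_dvd hk.two_le hkH
      have h2 : k ∣ 2 ^ 7 * 3 ^ 2 * 5 := hk5
      rw [hk.dvd_mul, hk.dvd_mul] at h2
      rcases h2 with (h2 | h2) | h2
      · have := Nat.le_of_dvd (by norm_num) (hk.dvd_of_dvd_pow h2); omega
      · have := Nat.le_of_dvd (by norm_num) (hk.dvd_of_dvd_pow h2); omega
      · have := Nat.le_of_dvd (by norm_num) h2; omega
    have : Nat.card H ∣ 7 := hcop.dvd_of_dvd_mul_left (n := 7) hdvd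
    exact ((Nat.dvd_prime (by norm_num)).1 this).resolve_left hcard
  · obtain ⟨σ, hσ, h1, ht⟩ := h.exists_mem_pow_eq_one_of_eleven_le hΓ h7 hx hxp
    have := hmin σ hσ h1 (p - 1) (by omega) ht
    omega

end AtMostThree

/-! ### Degree seven without three-cycles: generators of `PSL₂(7)` -/

namespace AtMostThree

section SevenPSL

variable {Γ H : Subgroup (Perm (Fin 7))}

/-- Both `(4 5 6)` and `(0 2)(1 3)` centralize the given involution. The first is excluded from `H`,
and cubing removes it from a product with the second. -/
theorem klein_seven_mem (h : AtMostThree Γ H) (hΓ : ∀ σ, sign σ = 1 → σ ∈ Γ)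
    (h3 : ∀ σ ∈ H, σ.cycleType ≠ {3}) (hx : c[0, 1] * c[2, 3] ∈ H) :
    c[0, 2] * c[1, 3] ∈ H := by
  rcases h.three hx (by decide) (z := c[4, 5, 6]) (t := c[0, 2] * c[1, 3])
    (hΓ _ (by decide)) (hΓ _ (by decide)) (by decide) (mem_of_eq (by decide) hx)
    (mem_of_eq (by decide) hx) (mem_of_eq (by decide) hx) with hq | hq | hq | hq
  · exact absurd (by decide) (h3 _ hq)
  · exact hq
  · exact mem_of_eq (by decide) (pow_mem hq 3)
  · exact mem_of_eq (by decide) (pow_mem hq 3)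

theorem exists_psl_generators_aux (h : AtMostThree Γ H) (hΓ : ∀ σ, sign σ = 1 → σ ∈ Γ)
    (h3 : ∀ σ ∈ H, σ.cycleType ≠ {3}) (hx : c[0, 1] * c[2, 3] ∈ H)
    (hy : c[0, 1, 2] * c[4, 5, 6] ∈ H) (ht : c[0, 1] * c[4, 5] ∈ H) :
    ∃ τ : Perm (Fin 7), τ * c[0, 1, 2, 3, 4, 5, 6] * τ⁻¹ ∈ H ∧
      τ * (c[1, 4] * c[5, 6]) * τ⁻¹ ∈ H := by
  have hw := h.klein_seven_mem hΓ h3 hx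
  have hu : c[0, 4] * c[1, 5] ∈ H := by
    rcases h.three ht (by decide) (z := c[2, 3, 6]) (t := c[0, 4] * c[1, 5])
      (hΓ _ (by decide)) (hΓ _ (by decide)) (by decide) (mem_of_eq (by decide) ht)
      (mem_of_eq (by decide) ht) (mem_of_eq (by decide) ht) with hq | hq | hq | hq
    · exact absurd (by decide) (h3 _ hq)
    · exact hq
    · exact mem_of_eq (by decide) (pow_mem hq 3)
    · exact mem_of_eq (by decide) (pow_mem hq 3)
  exact ⟨c[2, 3, 4] * c[5, 6], mem_of_eq (by decide) (mul_mem (mul_mem (inv_mem hy) hu) hw),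
    mem_of_eq (by decide) (mul_mem ht hy)⟩

theorem exists_psl_generators (h : AtMostThree Γ H) (hΓ : ∀ σ, sign σ = 1 → σ ∈ Γ)
    (h3 : ∀ σ ∈ H, σ.cycleType ≠ {3}) (hx : c[0, 1] * c[2, 3] ∈ H) :
    ∃ τ : Perm (Fin 7), τ * c[0, 1, 2, 3, 4, 5, 6] * τ⁻¹ ∈ H ∧
      τ * (c[1, 4] * c[5, 6]) * τ⁻¹ ∈ H := by
  have hw := h.klein_seven_mem hΓ h3 hx
  have key : ∀ ρ : Perm (Fin 7), c[0, 1] * c[2, 3] ∈ H.comap (MulAut.conj ρ).toMonoidHom →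
      c[0, 1, 2] * c[4, 5, 6] ∈ H.comap (MulAut.conj ρ).toMonoidHom →
      c[0, 1] * c[4, 5] ∈ H.comap (MulAut.conj ρ).toMonoidHom →
      ∃ τ : Perm (Fin 7), τ * c[0, 1, 2, 3, 4, 5, 6] * τ⁻¹ ∈ H ∧
        τ * (c[1, 4] * c[5, 6]) * τ⁻¹ ∈ H := by
    intro ρ h1 h2 h3'
    obtain ⟨τ, h4, h5⟩ := (h.relabel ρ).exists_psl_generators_aux
      (alternatingGroup_le_relabel hΓ ρ)
      (fun σ hσ => by simpa using h3 _ (mem_relabel.1 hσ)) h1 h2 h3'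
    exact ⟨ρ * τ, mem_of_eq (by group) (mem_relabel.1 h4), mem_of_eq (by group) (mem_relabel.1 h5)⟩
  have ht : c[0, 1] * c[4, 5] ∈ H ∨ c[0, 1] * c[4, 6] ∈ H ∨ c[0, 1] * c[5, 6] ∈ H := by
    rcases h.three hx (by decide) (z := c[4, 5, 6]) (t := c[0, 1] * c[4, 5])
      (hΓ _ (by decide)) (hΓ _ (by decide)) (by decide) (mem_of_eq (by decide) hx)
      (mem_of_eq (by decide) hx) (mem_of_eq (by decide) hx) with hq | hq | hq | hq
    · exact absurd (by decide) (h3 _ hq)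
    · exact Or.inl hq
    · exact Or.inr (Or.inl (mem_of_eq (by decide) hq))
    · exact Or.inr (Or.inr (mem_of_eq (by decide) hq))
  have hy : c[0, 1, 2] * c[4, 5, 6] ∈ H ∨ c[0, 1, 2] * c[4, 6, 5] ∈ H := by
    rcases h.three hx (by decide) (z := c[4, 5, 6]) (t := c[0, 1, 2])
      (hΓ _ (by decide)) (hΓ _ (by decide)) (by decide) (mem_of_eq (by decide) hx)
      (mem_of_eq (by decide) hx) (mem_of_eq (by decide) hw) with hq | hq | hq | hq
    · exact absurd (by decide) (h3 _ hq)
    · exact absurd (by decide) (h3 _ hq)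
    · exact Or.inl (mem_of_eq (by decide) hq)
    · exact Or.inr (mem_of_eq (by decide) hq)
  -- In each case a permutation of the points 4, 5, 6 brings the two elements to the standard form
  -- of `exists_psl_generators_aux`.
  rcases hy with hy | hy <;> rcases ht with ht | ht | ht
  · exact key 1 (mem_relabel.2 <| mem_of_eq (by decide) hx)
      (mem_relabel.2 <| mem_of_eq (by decide) hy) (mem_relabel.2 <| mem_of_eq (by decide) ht)
  · exact key c[4, 6, 5] (mem_relabel.2 <| mem_of_eq (by decide) hx)
      (mem_relabel.2 <| mem_of_eq (by decide) hy) (mem_relabel.2 <| mem_of_eq (by decide) ht)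
  · exact key c[4, 5, 6] (mem_relabel.2 <| mem_of_eq (by decide) hx)
      (mem_relabel.2 <| mem_of_eq (by decide) hy) (mem_relabel.2 <| mem_of_eq (by decide) ht)
  · exact key c[4, 5] (mem_relabel.2 <| mem_of_eq (by decide) hx)
      (mem_relabel.2 <| mem_of_eq (by decide) hy) (mem_relabel.2 <| mem_of_eq (by decide) ht)
  · exact key c[5, 6] (mem_relabel.2 <| mem_of_eq (by decide) hx)
      (mem_relabel.2 <| mem_of_eq (by decide) hy) (mem_relabel.2 <| mem_of_eq (by decide) ht)
  · exact key c[4, 6] (mem_relabel.2 <| mem_of_eq (by decide) hx)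
      (mem_relabel.2 <| mem_of_eq (by decide) hy) (mem_relabel.2 <| mem_of_eq (by decide) ht)

end SevenPSL

end AtMostThree

/-! ### `PSL₂(7)` as a permutation group on seven points -/

namespace PSLSeven

/-- The involution of the Fano plane by which the Weyl element acts. -/
def weyl : Perm (ZMod 7) := (c[1, 4] * c[5, 6] : Perm (Fin 7))

/-- The action of `!![a, b; c, d] ∈ SL₂(7)` on seven points, in Bruhat normal form. -/
def act (a b c d i : ZMod 7) : ZMod 7 :=
  -- For `c ≠ 0`, `c ^ 5` is the inverse of `c`, and the matrix is `!![1, a/c; 0, 1]` times the Weyl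
  -- element `!![0, -1; 1, 0]` times `!![c, d; 0, 1/c]`.
  if c = 0 then a ^ 2 * i + a * b else a * c ^ 5 + weyl (c ^ 2 * i + c * d)

instance : Fact (Nat.Prime 7) := ⟨by norm_num⟩

theorem pow_six : ∀ c : ZMod 7, c ≠ 0 → c * c ^ 5 = 1 := by decide

theorem act_unipotent {a b c d : ZMod 7} (h : a * d - b * c = 1) (k i : ZMod 7) :
    act (a + k * c) (b + k * d) c d i = act a b c d i + k := by
  unfold act
  by_cases hc : c = 0
  · subst hc
    simp only [if_true]
    linear_combination k * h
  · rw [if_neg hc, if_neg hc]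
    linear_combination k * pow_six c hc

theorem act_weyl : ∀ a b c d i : ZMod 7, a * d - b * c = 1 →
    act (-c) (-d) a b i = weyl (act a b c d i) := by
  decide +kernel

theorem weyl_mul : ∀ k l i : ZMod 7, k * l = 1 → weyl (l ^ 2 * i) = k ^ 2 * weyl i := by
  decide +kernel

theorem pow_five : ∀ k l : ZMod 7, k * l = 1 → l ^ 5 = k := by
  decide

theorem act_torus {a b c d k l : ZMod 7} (hkl : k * l = 1) (i : ZMod 7) :
    act (k * a) (k * b) (l * c) (l * d) i = k ^ 2 * act a b c d i := by
  have hl : l ≠ 0 := by rintro rfl; simp at hkl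
  unfold act
  by_cases hc : c = 0
  · subst hc
    simp only [mul_zero, if_true]
    ring
  · rw [if_neg hc, if_neg (mul_ne_zero hl hc)]
    have e : (l * c) ^ 2 * i + l * c * (l * d) = l ^ 2 * (c ^ 2 * i + c * d) := by ring
    rw [e, weyl_mul k l _ hkl, mul_pow, pow_five k l hkl]
    ring

/-- The left factor is decomposed into unipotent, diagonal and Weyl matrices, and `act_unipotent`,
`act_torus` and `act_weyl` give the effect of each. This avoids a search over pairs of matrices. -/
theorem act_mul {a b c d e f g h : ZMod 7} (h1 : a * d - b * c = 1) (h2 : e * h - f * g = 1)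
    (i : ZMod 7) :
    act (a * e + b * g) (a * f + b * h) (c * e + d * g) (c * f + d * h) i =
      act a b c d (act e f g h i) := by
  by_cases hc : c = 0
  · subst hc
    have had : a * d = 1 := by linear_combination h1
    have e1 : act (e + (b * d) * g) (f + (b * d) * h) g h i = act e f g h i + b * d :=
      act_unipotent h2 _ _
    have e2 := act_torus (a := e + (b * d) * g) (b := f + (b * d) * h) (c := g) (d := h) had i
    rw [e1] at e2
    have e3 : a * (e + b * d * g) = a * e + b * g := by linear_combination b * g * had
    have e4 : a * (f + b * d * h) = a * f + b * h := by linear_combination b * h * had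
    rw [e3, e4] at e2
    rw [zero_mul, zero_add, zero_mul, zero_add, e2]
    conv_rhs => rw [act, if_pos rfl]
    linear_combination a * b * had
  · have hcc : c * c ^ 5 = 1 := pow_six c hc
    have e1 := act_unipotent h2 (d * c ^ 5) i
    have e2 := act_torus (a := e + d * c ^ 5 * g) (b := f + d * c ^ 5 * h) (c := g) (d := h) hcc i
    rw [e1] at e2
    have d2 : (c * (e + d * c ^ 5 * g)) * (c ^ 5 * h) - (c * (f + d * c ^ 5 * h)) * (c ^ 5 * g) = 1 := by
      linear_combination (e * h - f * g) * hcc + h2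
    have e3 := act_weyl _ _ _ _ i d2
    have d3 : (-(c ^ 5 * g)) * (c * (f + d * c ^ 5 * h)) - (-(c ^ 5 * h)) * (c * (e + d * c ^ 5 * g)) = 1 := by
      linear_combination d2
    have e4 := act_unipotent d3 (a * c ^ 5) i
    rw [e3, e2] at e4
    have f1 : c * (e + d * c ^ 5 * g) = c * e + d * g := by linear_combination d * g * hcc
    have f2 : c * (f + d * c ^ 5 * h) = c * f + d * h := by linear_combination d * h * hcc
    rw [f1, f2] at e4
    have f3 : -(c ^ 5 * g) + a * c ^ 5 * (c * e + d * g) = a * e + b * g := by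
      linear_combination c ^ 5 * g * h1 + (a * e + b * g) * hcc
    have f4 : -(c ^ 5 * h) + a * c ^ 5 * (c * f + d * h) = a * f + b * h := by
      linear_combination c ^ 5 * h * h1 + (a * f + b * h) * hcc
    rw [f3, f4] at e4
    rw [e4]
    conv_rhs => rw [act, if_neg hc]
    rw [add_comm (a * c ^ 5)]
    congr 3
    linear_combination c * d * hcc

theorem det_eq (A : Matrix.SpecialLinearGroup (Fin 2) (ZMod 7)) :
    A 0 0 * A 1 1 - A 0 1 * A 1 0 = 1 := by
  rw [← Matrix.det_fin_two]
  exact A.det_coe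

/-- The action of a matrix of `SL₂(7)` on seven points. -/
def actMatrix (A : Matrix.SpecialLinearGroup (Fin 2) (ZMod 7)) (i : ZMod 7) : ZMod 7 :=
  act (A 0 0) (A 0 1) (A 1 0) (A 1 1) i

theorem actMatrix_one (i : ZMod 7) : actMatrix 1 i = i := by
  simp [actMatrix, act]

theorem actMatrix_mul (A B : Matrix.SpecialLinearGroup (Fin 2) (ZMod 7)) (i : ZMod 7) :
    actMatrix (A * B) i = actMatrix A (actMatrix B i) := by
  rw [actMatrix, actMatrix, actMatrix, ← act_mul (det_eq A) (det_eq B)]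
  simp [Matrix.mul_apply, Fin.sum_univ_two]

/-- The permutation representation of `SL₂(7)` of degree seven. -/
def toPerm : Matrix.SpecialLinearGroup (Fin 2) (ZMod 7) →* Perm (ZMod 7) where
  toFun A :=
    { toFun := actMatrix A
      invFun := actMatrix A⁻¹
      left_inv := fun i => by rw [← actMatrix_mul, inv_mul_cancel, actMatrix_one]
      right_inv := fun i => by rw [← actMatrix_mul, mul_inv_cancel, actMatrix_one] }
  map_one' := Equiv.ext actMatrix_one
  map_mul' A B := Equiv.ext (actMatrix_mul A B)

theorem toPerm_apply (A : Matrix.SpecialLinearGroup (Fin 2) (ZMod 7)) (i : ZMod 7) :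
    toPerm A i = act (A 0 0) (A 0 1) (A 1 0) (A 1 1) i :=
  rfl

theorem scalar_of_act : ∀ a b c d : ZMod 7, a * d - b * c = 1 → (∀ i, act a b c d i = i) →
    b = 0 ∧ c = 0 ∧ a = d := by
  decide +kernel

theorem ker_toPerm : toPerm.ker =
    Subgroup.center (Matrix.SpecialLinearGroup (Fin 2) (ZMod 7)) := by
  ext A
  rw [MonoidHom.mem_ker, Matrix.SpecialLinearGroup.mem_center_iff]
  have hA := det_eq A
  constructor
  · intro h
    obtain ⟨hb, hc, hd⟩ := scalar_of_act _ _ _ _ hA fun i => by rw [← toPerm_apply, h]; rfl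
    refine ⟨A 0 0, ?_, ?_⟩
    · rw [hb, hd] at hA
      rw [hd, Fintype.card_fin]
      linear_combination hA
    · ext i j
      fin_cases i <;> fin_cases j <;> simp [hb, hc, hd]
  · rintro ⟨r, hr, hs⟩
    have h00 := congrFun (congrFun hs 0) 0
    have h01 := congrFun (congrFun hs 0) 1
    have h10 := congrFun (congrFun hs 1) 0
    simp at h00 h01 h10
    ext i
    rw [toPerm_apply, ← h00, ← h01, ← h10, act, if_pos rfl]
    rw [Fintype.card_fin] at hr
    rw [hr]
    simp

/-- `PSL₂(7)` as a permutation group of degree seven. -/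
noncomputable def pslEquiv :
    Matrix.ProjectiveSpecialLinearGroup (Fin 2) (ZMod 7) ≃* toPerm.range :=
  (QuotientGroup.quotientMulEquivOfEq ker_toPerm.symm).trans
    (QuotientGroup.quotientKerEquivRange toPerm)

theorem card_specialLinearGroup :
    Nat.card (Matrix.SpecialLinearGroup (Fin 2) (ZMod 7)) = 336 := by
  let e : Matrix.SpecialLinearGroup (Fin 2) (ZMod 7) ≃
      {p : ZMod 7 × ZMod 7 × ZMod 7 × ZMod 7 // p.1 * p.2.2.2 - p.2.1 * p.2.2.1 = 1} :=
    { toFun := fun A => ⟨(A 0 0, A 0 1, A 1 0, A 1 1), det_eq A⟩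
      invFun := fun p => ⟨!![p.1.1, p.1.2.1; p.1.2.2.1, p.1.2.2.2], by
        rw [Matrix.det_fin_two]; exact p.2⟩
      left_inv := fun A => by
        ext i j
        fin_cases i <;> fin_cases j <;> rfl
      right_inv := fun p => rfl }
  rw [Nat.card_congr e, Nat.card_eq_fintype_card]
  decide +kernel

theorem card_center_le :
    Nat.card (Subgroup.center (Matrix.SpecialLinearGroup (Fin 2) (ZMod 7))) ≤ 2 := by
  rw [Nat.card_congr (Matrix.SpecialLinearGroup.center_equiv_rootsOfUnity' 0).toEquiv]
  exact card_rootsOfUnity _ _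

/-- The kernel is the center, of order at most 2 in a group of order 336; this bound on the center
suffices. -/
theorem card_range_toPerm : 168 ∣ Nat.card toPerm.range ∧ 168 ≤ Nat.card toPerm.range := by
  have h := Subgroup.card_mul_index toPerm.ker
  rw [card_specialLinearGroup, Subgroup.index_ker, ker_toPerm] at h
  have h2 := card_center_le
  set k := Nat.card (Subgroup.center (Matrix.SpecialLinearGroup (Fin 2) (ZMod 7)))
  interval_cases k <;> omega

/-- With `u k = !![1, k; 0, 1]` and `w` the Weyl element, the matrix equals `u ((a+1)/c) * w * u c *
w * u ((d+1)/c)`. For `c = 0` one further `w` on the left reduces to this case up to sign. Hence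
translations and `weyl` generate the image. -/
theorem act_eq_of_ne_zero : ∀ a b c d : ZMod 7, a * d - b * c = 1 → c ≠ 0 → ∀ i,
    act a b c d i = weyl (weyl (i + (d + 1) * c ^ 5) + c) + (a + 1) * c ^ 5 := by
  decide +kernel

theorem act_eq_of_eq_zero : ∀ a b d : ZMod 7, a * d = 1 → ∀ i,
    act a b 0 d i = weyl (weyl (weyl (i + (b + 1) * a ^ 5) + a) + a ^ 5) := by
  decide +kernel

theorem range_toPerm_le {K : Subgroup (Perm (ZMod 7))} (h1 : Equiv.addRight 1 ∈ K)
    (h2 : weyl ∈ K) : toPerm.range ≤ K := by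
  have hk : ∀ k : ZMod 7, Equiv.addRight k ∈ K := fun k => by
    refine mem_of_eq (Equiv.ext fun i => ?_) (pow_mem h1 k.val)
    exact AtMostThree.addRight_one_pow_val_apply k i
  rintro _ ⟨A, rfl⟩
  have hA := det_eq A
  by_cases hc : A 1 0 = 0
  · refine mem_of_eq (Equiv.ext fun i => ?_) (mul_mem (mul_mem (mul_mem (mul_mem (mul_mem h2
      (hk (A 0 0 ^ 5))) h2) (hk (A 0 0))) h2) (hk ((A 0 1 + 1) * A 0 0 ^ 5)))
    rw [toPerm_apply, hc, act_eq_of_eq_zero _ _ _ (by rw [hc] at hA; linear_combination hA)]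
    simp only [mul_apply, coe_addRight]
  · refine mem_of_eq (Equiv.ext fun i => ?_) (mul_mem (mul_mem (mul_mem (mul_mem
      (hk ((A 0 0 + 1) * A 1 0 ^ 5)) h2) (hk (A 1 0))) h2) (hk ((A 1 1 + 1) * A 1 0 ^ 5)))
    rw [toPerm_apply, act_eq_of_ne_zero _ _ _ _ hA hc]
    simp only [mul_apply, coe_addRight]

/-- A subgroup of order at most `168` containing the standard generators is `PSL₂(7)`. -/
theorem mulEquiv_psl {K : Subgroup (Perm (ZMod 7))} (hK : Nat.card K ≤ 168)
    (h1 : Equiv.addRight 1 ∈ K) (h2 : weyl ∈ K) :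
    Nonempty (K ≃* Matrix.ProjectiveSpecialLinearGroup (Fin 2) (ZMod 7)) := by
  have heq : toPerm.range = K :=
    Subgroup.eq_of_le_of_card_ge (range_toPerm_le h1 h2) (hK.trans card_range_toPerm.2)
  exact ⟨(MulEquiv.subgroupCongr heq).symm.trans pslEquiv.symm⟩

theorem addRight_one_eq :
    Equiv.addRight (1 : ZMod 7) =
      (show Perm (ZMod 7) from (c[0, 1, 2, 3, 4, 5, 6] : Perm (Fin 7))) :=
  Equiv.ext (by decide +kernel)

theorem dvd_card {K : Subgroup (Perm (ZMod 7))} (h1 : Equiv.addRight 1 ∈ K) (h2 : weyl ∈ K) :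
    168 ∣ Nat.card K :=
  card_range_toPerm.1.trans (Subgroup.card_dvd_of_le (range_toPerm_le h1 h2))

end PSLSeven

section

variable {K : Subgroup (Perm (Fin 7))}

theorem nonempty_mulEquiv_psl (hK : Nat.card K ≤ 168)
    (h1 : c[0, 1, 2, 3, 4, 5, 6] ∈ K) (h2 : c[1, 4] * c[5, 6] ∈ K) :
    Nonempty (K ≃* Matrix.ProjectiveSpecialLinearGroup (Fin 2) (ZMod 7)) :=
  PSLSeven.mulEquiv_psl (K := K) hK (PSLSeven.addRight_one_eq ▸ h1) h2

theorem dvd_card_of_psl_generators (h1 : c[0, 1, 2, 3, 4, 5, 6] ∈ K)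
    (h2 : c[1, 4] * c[5, 6] ∈ K) : 168 ∣ Nat.card K :=
  PSLSeven.dvd_card (K := K) (PSLSeven.addRight_one_eq ▸ h1) h2

end

/-! ### The possible stabilizers in degree at least seven -/

namespace AtMostThree

/-- A preimage under an isomorphism is isomorphic to the original subgroup. -/
noncomputable def _root_.MulEquiv.comapEquiv {M M' : Type*} [Group M] [Group M'] (e : M ≃* M')
    (H : Subgroup M') : H.comap e.toMonoidHom ≃* H :=
  (e.subgroupMap _).trans
    (MulEquiv.subgroupCongr (Subgroup.map_comap_eq_self_of_surjective e.surjective H))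

theorem exists_relabel_mem {α : Type*} [Fintype α] [DecidableEq α] {H : Subgroup (Perm α)}
    {σ τ : Perm α} (hσ : σ ∈ H) (h : σ.cycleType = τ.cycleType) :
    ∃ ρ : Perm α, τ ∈ H.comap (MulAut.conj ρ).toMonoidHom := by
  obtain ⟨ρ, hρ⟩ := isConj_iff.1 (isConj_iff_cycleType_eq.2 h.symm)
  exact ⟨ρ, mem_relabel.2 (mem_of_eq hρ.symm hσ)⟩

section

variable {α : Type*} [Fintype α] [DecidableEq α] {Γ H : Subgroup (Perm α)}

/-- In degree at least seven, a nontrivial stabilizer not containing the alternating group has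
order `7`, or the degree is `7` and it contains double transpositions but no three-cycles. -/
theorem card_eq_or_of_seven_le (h : AtMostThree Γ H) (hΓ : ∀ σ, sign σ = 1 → σ ∈ Γ)
    (hc : 7 ≤ Fintype.card α) (hH : H ≠ ⊥) (hA : ¬ alternatingGroup α ≤ H) :
    (Fintype.card α ≤ 8 ∧ Nat.card H = 7) ∨
      Fintype.card α = 7 ∧ (∃ σ ∈ H, σ.cycleType = {2, 2}) ∧ ∀ σ ∈ H, σ.cycleType ≠ {3} := by
  have h3 : ∀ σ ∈ H, σ.cycleType ≠ {3} := fun σ hσ h3 => hA (h.alternatingGroup_le_of_mem hΓ hc hσ h3)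
  rcases h.exists_cycleType hΓ hc hH with ⟨σ, hσ, ht | ht | ht⟩ | hd
  · obtain ⟨τ, hτ, ht⟩ := h.exists_isThreeCycle_of_cycleType_eq_two hΓ hc hσ ht
    exact absurd ht (h3 τ hτ)
  · exact absurd ht (h3 σ hσ)
  · right
    refine ⟨le_antisymm ?_ hc, ⟨σ, hσ, ht⟩, h3⟩
    by_contra! hc8
    exact hA (h.alternatingGroup_le_of_eight_le hΓ hc8 hσ ht)
  · exact Or.inl hd

end

theorem not_cycleType_two_two {H : Subgroup (Perm (Fin 7))} (h : AtMostThree ⊤ H)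
    (h3 : ∀ σ ∈ H, σ.cycleType ≠ {3}) {x : Perm (Fin 7)} (hx : x ∈ H) : x.cycleType ≠ {2, 2} := by
  intro hx2
  obtain ⟨ρ, hρ⟩ := exists_relabel_mem (τ := c[0, 1] * c[2, 3]) hx (hx2.trans (by decide))
  have h' := h.relabel ρ
  rw [Subgroup.comap_top] at h'
  obtain ⟨σ, hσ, hσ3⟩ := h'.exists_isThreeCycle_symmetric_seven hρ
  exact h3 _ hσ ((cycleType_conj).trans hσ3)

set_option maxRecDepth 4000 in
/-- Stabilizers of order seven do not occur in symmetric groups. -/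
theorem card_ne_seven {n : ℕ} (hn : 7 ≤ n) {H : Subgroup (Perm (Fin n))} (h : AtMostThree ⊤ H) :
    Nat.card H ≠ 7 := by
  intro hH
  have e : (Equiv.addRight (1 : ZMod 7)).cycleType = {7} := by decide
  have : Fact (Nat.Prime 7) := ⟨by norm_num⟩
  obtain ⟨⟨x, hx⟩, hxp⟩ := exists_prime_orderOf_dvd_card' (G := H) 7 hH.symm.dvd
  rw [Subgroup.orderOf_mk] at hxp
  obtain ⟨f, hf⟩ := h.exists_viaEmbeddingHom_addRight_mem (fun _ _ => Subgroup.mem_top _)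
    (by norm_num) hx hxp
  obtain ⟨g, hg⟩ := exists_viaEmbeddingHom_eq (τ := (c[0, 1, 2, 3, 4, 5, 6] : Perm (Fin 7)))
    (σ := viaEmbeddingHom f (Equiv.addRight 1))
    (by rw [cycleType_viaEmbeddingHom]; exact e.trans (by decide)) (by simpa using hn)
  rw [← hg] at hf
  have key : ∀ σ : Perm (Fin 7), σ ≠ 1 ∧ σ ^ 6 = 1 → σ ∉ H.comap (viaEmbeddingHom g) := by
    rintro σ ⟨h1, h6⟩ hσ
    have hd := orderOf_dvd_natCard (⟨viaEmbeddingHom g σ, hσ⟩ : H)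
    rw [← Subgroup.orderOf_coe, orderOf_injective _ (viaEmbeddingHom_injective g), hH] at hd
    have := Nat.dvd_gcd hd (orderOf_dvd_of_pow_eq_one h6)
    exact h1 (orderOf_eq_one_iff.1 (Nat.dvd_one.1 this))
  -- The odd six-cycle `i ↦ 3 * i` normalizes the seven-cycle and is itself available in the
  -- symmetric group; its powers have order prime to 7.
  rcases (h.comap_viaEmbedding g).pow_mem_or (x := c[0, 1, 2, 3, 4, 5, 6])
    (u := c[1, 3, 2, 6, 4, 5]) hf (by decide) (Subgroup.mem_top _) 5 (by decide) with hq | hq | hq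
  all_goals exact key _ (by decide) hq

theorem psl_of_cycleType_two_two {Γ H : Subgroup (Perm (Fin 7))} (h : AtMostThree Γ H)
    (hΓ : ∀ σ, sign σ = 1 → σ ∈ Γ) (h3 : ∀ σ ∈ H, σ.cycleType ≠ {3}) {x : Perm (Fin 7)}
    (hx : x ∈ H) (hx2 : x.cycleType = {2, 2}) : 168 ∣ Nat.card H ∧
      (Nat.card H = 168 → Nonempty (H ≃* Matrix.ProjectiveSpecialLinearGroup (Fin 2) (ZMod 7))) := by
  obtain ⟨ρ, hρ⟩ := exists_relabel_mem (τ := c[0, 1] * c[2, 3]) hx (hx2.trans (by decide))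
  obtain ⟨τ, h1, h2⟩ := (h.relabel ρ).exists_psl_generators (alternatingGroup_le_relabel hΓ ρ)
    (fun σ hσ h0 => h3 _ hσ (cycleType_conj.trans h0)) hρ
  let K := (H.comap (MulAut.conj ρ).toMonoidHom).comap (MulAut.conj τ).toMonoidHom
  let e : K ≃* H := ((MulAut.conj τ).comapEquiv _).trans ((MulAut.conj ρ).comapEquiv _)
  have hc : Nat.card K = Nat.card H := Nat.card_congr e.toEquiv
  rw [← hc]
  exact ⟨dvd_card_of_psl_generators h1 h2, fun h168 =>
    (nonempty_mulEquiv_psl (K := K) h168.le h1 h2).map e.symm.trans⟩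

end AtMostThree

/-! ### Point stabilizers and fixed-point counts -/

/-- The number of points fixed by a group element. -/
noncomputable def fixCard {G : Type*} (Ω : Type*) [Group G] [MulAction G Ω] (g : G) : ℕ :=
  Nat.card (MulAction.fixedBy Ω g)

namespace IsThreeFixAction

variable {G Ω : Type*} [Group G] [MulAction G Ω]

theorem actsAsOnCosets (h : IsThreeFixAction G Ω) (ω : Ω) :
    ActsAsOnCosets G Ω (MulAction.stabilizer G ω) := by
  have := h.transitive
  have hb : Function.Bijective (MulAction.ofQuotientStabilizer G ω) := by
    refine ⟨MulAction.injective_ofQuotientStabilizer G ω, fun y => ?_⟩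
    obtain ⟨g, rfl⟩ := MulAction.exists_smul_eq G ω y
    exact ⟨g, rfl⟩
  refine ⟨(Equiv.ofBijective _ hb).symm, fun g x => ?_⟩
  rw [Equiv.symm_apply_eq, Equiv.ofBijective_apply, MulAction.ofQuotientStabilizer_smul]
  congr 1
  exact ((Equiv.ofBijective _ hb).apply_symm_apply x).symm

/-- That `a⁻¹ * x * a` stabilizes `ω` means that `x` fixes `a • ω`, so four distinct cosets would be
four distinct fixed points. -/
theorem atMostThree (h : IsThreeFixAction G Ω) {M : Type*} [Group M] {φ : G →* M}
    (hφ : Function.Injective φ) (ω : Ω) :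
    AtMostThree φ.range ((MulAction.stabilizer G ω).map φ) := by
  have hmem : ∀ g, φ g ∈ (MulAction.stabilizer G ω).map φ ↔ g • ω = ω := fun g => by
    rw [Subgroup.mem_map_iff_mem hφ, MulAction.mem_stabilizer_iff]
  rintro _ ⟨x, hx, rfl⟩ hx1 _ ⟨a, rfl⟩ _ ⟨b, rfl⟩ _ ⟨c, rfl⟩
  simp only [← map_inv, ← map_mul, hmem, mul_smul, inv_smul_eq_iff]
  intro ha hb hc
  by_contra! hn
  obtain ⟨h1, h2, h3, h4, h5, h6⟩ := hn
  have h0 := h.four_point ω (a • ω) (b • ω) (c • ω) h1.symm h2.symm h3.symm h4.symm h5.symm h6.symm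
  have hxm : x ∈ (⊥ : Subgroup G) := h0 ▸ ⟨⟨⟨hx, ha⟩, hb⟩, hc⟩
  exact hx1 (by rw [Subgroup.mem_bot.1 hxm, map_one])

theorem eq_bot_of_normal (h : IsThreeFixAction G Ω) (ω : Ω) {K : Subgroup G} [K.Normal]
    (hK : K ≤ MulAction.stabilizer G ω) : K = ⊥ := by
  have := h.transitive
  have := h.faithful
  rw [eq_bot_iff]
  intro k hk
  rw [Subgroup.mem_bot]
  refine FaithfulSMul.eq_of_smul_eq_smul (α := Ω) fun y => ?_
  obtain ⟨g, rfl⟩ := MulAction.exists_smul_eq G ω y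
  have h1 : (g⁻¹ * k * g) • ω = ω := by
    have : g⁻¹ * k * g⁻¹⁻¹ ∈ K := Subgroup.Normal.conj_mem ‹_› k hk g⁻¹
    rw [inv_inv] at this
    exact hK this
  rw [mul_smul, mul_smul, inv_smul_eq_iff] at h1
  rw [h1, one_smul]

/-- The preimage of the alternating group would be a normal subgroup inside a stabilizer, hence
trivial by faithfulness. -/
theorem not_alternatingGroup_le (h : IsThreeFixAction G Ω) {n : ℕ} (hn : 3 ≤ n)
    {φ : G →* Perm (Fin n)} (hφ : Function.Injective φ) (ω : Ω) :
    ¬ alternatingGroup (Fin n) ≤ (MulAction.stabilizer G ω).map φ := by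
  intro hA
  have hK : (alternatingGroup (Fin n)).comap φ ≤ MulAction.stabilizer G ω := fun g hg => by
    rw [← Subgroup.mem_map_iff_mem hφ]
    exact hA hg
  have h0 := h.eq_bot_of_normal ω hK
  have := Subgroup.map_comap_eq_self (hA.trans (Subgroup.map_le_range _ _))
  rw [h0, Subgroup.map_bot] at this
  have hne : Nontrivial (alternatingGroup (Fin n)) :=
    alternatingGroup.nontrivial_of_three_le_card (by simpa using hn)
  exact ((Subgroup.nontrivial_iff_ne_bot _).1 hne) this.symm

theorem stabilizer_ne_bot (h : IsThreeFixAction G Ω) (ω : Ω) : MulAction.stabilizer G ω ≠ ⊥ := by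
  intro h0
  have := h.transitive
  obtain ⟨a, ha⟩ := h.nonregular
  obtain ⟨g, rfl⟩ := MulAction.exists_smul_eq G a ω
  refine ha ((Subgroup.eq_bot_iff_forall _).2 fun x hx => ?_)
  have : g * x * g⁻¹ ∈ MulAction.stabilizer G (g • a) := by
    rw [MulAction.mem_stabilizer_iff, mul_smul, mul_smul, inv_smul_smul]
    rw [MulAction.mem_stabilizer_iff.1 hx]
  rw [h0, Subgroup.mem_bot] at this
  simpa using this

theorem card_mul (h : IsThreeFixAction G Ω) (ω : Ω) :
    Nat.card Ω * Nat.card (MulAction.stabilizer G ω) = Nat.card G := by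
  have := h.transitive
  rw [← MulAction.index_stabilizer_of_transitive G ω, mul_comm, Subgroup.card_mul_index]

theorem fixCard_one : fixCard Ω (1 : G) = Nat.card Ω := by
  rw [fixCard, MulAction.fixedBy_one_eq_univ]
  exact Nat.card_congr (Equiv.Set.univ Ω)

theorem fixCard_conj (g k : G) : fixCard Ω (k * g * k⁻¹) = fixCard Ω g := by
  rw [fixCard, fixCard]
  refine Nat.card_congr ((MulAction.toPerm k).symm.subtypeEquiv fun y => ?_)
  change (k * g * k⁻¹) • y = y ↔ g • k⁻¹ • y = k⁻¹ • y
  rw [mul_smul, mul_smul, smul_eq_iff_eq_inv_smul]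

variable [Finite G]

theorem finite (h : IsThreeFixAction G Ω) : Finite Ω := by
  have := h.transitive
  obtain ⟨a, -⟩ := h.nonregular
  exact Finite.of_surjective (fun g : G => g • a) (MulAction.surjective_smul G a)

theorem card_stabilizer_eq (h : IsThreeFixAction G Ω) (ω y : Ω) :
    Nat.card (MulAction.stabilizer G ω) = Nat.card (MulAction.stabilizer G y) := by
  have := h.finite
  have h2 := h.card_mul ω
  rw [← h.card_mul y] at h2
  exact Nat.eq_of_mul_eq_mul_left (Nat.card_pos_iff.2 ⟨⟨ω⟩, this⟩) h2

theorem fixCard_le_three (h : IsThreeFixAction G Ω) {g : G} (hg : g ≠ 1) : fixCard Ω g ≤ 3 := by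
  have := h.finite
  by_contra! hc
  have := Fintype.ofFinite (MulAction.fixedBy Ω g)
  obtain ⟨f⟩ := Function.Embedding.nonempty_of_card_le (α := Fin 4) (β := MulAction.fixedBy Ω g)
    (by rw [Fintype.card_fin, ← Nat.card_eq_fintype_card]; exact hc)
  have hne : ∀ i j : Fin 4, i ≠ j → (f i : Ω) ≠ f j := fun i j hij h0 =>
    hij (f.injective (Subtype.ext h0))
  have h0 := h.four_point (f 0) (f 1) (f 2) (f 3) (hne _ _ (by decide)) (hne _ _ (by decide))
    (hne _ _ (by decide)) (hne _ _ (by decide)) (hne _ _ (by decide)) (hne _ _ (by decide))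
  have hgm : g ∈ (⊥ : Subgroup G) := h0 ▸ ⟨⟨⟨(f 0).2, (f 1).2⟩, (f 2).2⟩, (f 3).2⟩
  exact hg (Subgroup.mem_bot.1 hgm)

theorem fixCard_le_pow (h : IsThreeFixAction G Ω) (g : G) (m : ℕ) :
    fixCard Ω g ≤ fixCard Ω (g ^ m) := by
  have := h.finite
  refine Nat.card_le_card_of_injective (fun y => ⟨y.1, ?_⟩) fun y z hyz =>
    Subtype.ext (congrArg (fun w : MulAction.fixedBy Ω (g ^ m) => w.1) hyz)
  exact pow_mem (show g ∈ MulAction.stabilizer G y.1 from y.2) m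

/-- On the fixed points of `g ^ p` the element `g` acts with orbits of length 1 or `p`, and those of
length 1 are its own fixed points. -/
theorem fixCard_modEq (h : IsThreeFixAction G Ω) (g : G) {p : ℕ} (hp : p.Prime) :
    fixCard Ω (g ^ p) ≡ fixCard Ω g [MOD p] := by
  classical
  have := h.finite
  have : Fact p.Prime := ⟨hp⟩
  have := Fintype.ofFinite (MulAction.fixedBy Ω (g ^ p))
  let f : Function.End (MulAction.fixedBy Ω (g ^ p)) := fun y => ⟨g • y.1, by
    rw [MulAction.mem_fixedBy, smul_smul, ← pow_succ, pow_succ', mul_smul, y.2]⟩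
  have hf : ∀ m (y : MulAction.fixedBy Ω (g ^ p)), ((f ^ m) y : Ω) = g ^ m • (y : Ω) := by
    intro m
    induction m with
    | zero => intro y; simp [Function.End.one_def]
    | succ m ih =>
      intro y
      rw [pow_succ, pow_succ, mul_smul]
      exact ih (f y)
  have hf1 : f ^ p ^ 1 = 1 := by
    rw [pow_one]
    funext y
    exact Subtype.ext ((hf p y).trans y.2)
  have key := Equiv.Perm.card_fixedPoints_modEq hf1
  rw [← Nat.card_eq_fintype_card, ← Nat.card_eq_fintype_card] at key
  refine key.trans (congrArg (· % p) (Nat.card_congr ?_))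
  exact
    { toFun := fun y => ⟨y.1.1, congrArg Subtype.val (show f y.1 = y.1 from y.2)⟩
      invFun := fun y => ⟨⟨y.1, pow_mem (show g ∈ MulAction.stabilizer G y.1 from y.2) p⟩,
        Subtype.ext y.2⟩
      left_inv := fun y => rfl
      right_inv := fun y => rfl }

theorem card_modEq (h : IsThreeFixAction G Ω) {g : G} {p : ℕ} (hp : p.Prime) (hg : g ^ p = 1) :
    Nat.card Ω ≡ fixCard Ω g [MOD p] := by
  have := h.fixCard_modEq g hp
  rwa [hg, fixCard_one] at this

theorem orderOf_dvd (h : IsThreeFixAction G Ω) (ω : Ω) {g : G} (hg : fixCard Ω g ≠ 0) :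
    orderOf g ∣ Nat.card (MulAction.stabilizer G ω) := by
  have := h.finite
  obtain ⟨⟨y, hy⟩⟩ := (Nat.card_pos_iff.1 (Nat.pos_of_ne_zero hg)).1
  rw [h.card_stabilizer_eq ω y]
  exact Subgroup.orderOf_dvd_natCard _ (show g ∈ MulAction.stabilizer G y from hy)

/-- Cauchy's theorem in a nontrivial three-point stabilizer. -/
theorem exists_fixCard_eq_three (h : IsThreeFixAction G Ω) :
    ∃ g : G, (orderOf g).Prime ∧ fixCard Ω g = 3 := by
  have := h.finite
  obtain ⟨a, b, c, hab, hac, hbc, hK⟩ := h.three_point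
  have hcard := mt Subgroup.card_eq_one.1 hK
  obtain ⟨p, hp, hpd⟩ := Nat.exists_prime_and_dvd hcard
  have : Fact p.Prime := ⟨hp⟩
  obtain ⟨⟨g, hg⟩, hgo⟩ := exists_prime_orderOf_dvd_card' p hpd
  rw [Subgroup.orderOf_mk] at hgo
  have hg1 : g ≠ 1 := by
    rintro rfl
    rw [orderOf_one] at hgo
    exact hp.one_lt.ne hgo
  refine ⟨g, hgo ▸ hp, le_antisymm (h.fixCard_le_three hg1) ?_⟩
  have hsub : ({a, b, c} : Set Ω) ⊆ MulAction.fixedBy Ω g := by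
    rintro _ (rfl | rfl | rfl)
    exacts [hg.1.1, hg.1.2, hg.2]
  calc 3 = Set.ncard {a, b, c} := (Set.ncard_eq_three.2 ⟨a, b, c, hab, hac, hbc, rfl⟩).symm
    _ ≤ _ := Set.ncard_le_ncard hsub

theorem exists_prime (h : IsThreeFixAction G Ω) (ω : Ω) :
    ∃ p : ℕ, p.Prime ∧ p ∣ Nat.card (MulAction.stabilizer G ω) ∧ Nat.card Ω ≡ 3 [MOD p] := by
  obtain ⟨g, hp, hg⟩ := h.exists_fixCard_eq_three
  refine ⟨_, hp, h.orderOf_dvd ω (by omega), ?_⟩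
  rw [← hg]
  exact h.card_modEq hp (pow_orderOf_eq_one g)

/-- A nontrivial element of prime order `p` fixing exactly three points moves some point, so `|Ω| -
3` is a positive multiple of `p ≥ 2`. -/
theorem five_le_card (h : IsThreeFixAction G Ω) : 5 ≤ Nat.card Ω := by
  have := h.finite
  have := h.faithful
  obtain ⟨g, hp, hg⟩ := h.exists_fixCard_eq_three
  have h1 := h.card_modEq hp (pow_orderOf_eq_one g)
  rw [hg] at h1
  have h3 : 3 ≤ Nat.card Ω := by
    rw [← hg, ← fixCard_one (G := G)]
    simpa using h.fixCard_le_pow g (orderOf g)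
  have h4 : Nat.card Ω ≠ 3 := by
    intro h4
    have hfix : MulAction.fixedBy Ω g = Set.univ :=
      Set.eq_of_subset_of_ncard_le (Set.subset_univ _) (by
        rw [Set.ncard_univ, h4, ← hg]; rfl)
    have : g = 1 := FaithfulSMul.eq_of_smul_eq_smul (α := Ω) fun y => by
      rw [one_smul]
      exact (Set.ext_iff.1 hfix y).2 (Set.mem_univ y)
    rw [this, orderOf_one] at hp
    exact Nat.not_prime_one hp
  have h5 := (Nat.modEq_iff_dvd' h3).1 h1.symm
  have := Nat.le_of_dvd (by omega) h5
  have := hp.two_le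
  omega

theorem card_dvd_factorial (h : IsThreeFixAction G Ω) : Nat.card G ∣ (Nat.card Ω).factorial := by
  have := h.finite
  have := h.faithful
  rw [← Nat.card_perm]
  exact Subgroup.card_dvd_of_injective (MulAction.toPermHom G Ω) MulAction.toPerm_injective

theorem sum_fixCard [Fintype G] (h : IsThreeFixAction G Ω) :
    ∑ g : G, fixCard Ω g = Nat.card G := by
  classical
  have := h.finite
  have := Fintype.ofFinite Ω
  have := h.transitive
  have := Fintype.ofFinite (MulAction.orbitRel.Quotient G Ω)
  have key := MulAction.sum_card_fixedBy_eq_card_orbits_mul_card_group G Ω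
  obtain ⟨a, -⟩ := h.nonregular
  have hs : Subsingleton (MulAction.orbitRel.Quotient G Ω) :=
    (MulAction.pretransitive_iff_subsingleton_quotient G Ω).1 h.transitive
  have : Fintype.card (MulAction.orbitRel.Quotient G Ω) = 1 :=
    Fintype.card_eq_one_iff.2 ⟨Quotient.mk'' a, fun y => Subsingleton.elim _ _⟩
  rw [this, one_mul] at key
  rw [Nat.card_eq_fintype_card, ← key]
  exact Finset.sum_congr rfl fun g _ => Nat.card_eq_fintype_card

end IsThreeFixAction

/-- The degrees compatible with the order `m` of a group having three-point fixing elements. -/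
def admissibleDegrees (m : ℕ) : Finset ℕ :=
  -- Primality of `p` is dropped; this can only enlarge the set.
  (Finset.Icc 5 m).filter fun N =>
    N ∣ m ∧ ∃ p ∈ Finset.Icc 2 (m / N), p ∣ m / N ∧ N % p = 3 % p

/-! ### Recognizing the actions, and degrees other than six -/

namespace IsThreeFixAction

variable {G Ω : Type*} [Group G] [MulAction G Ω]

theorem exists_sylow (h : IsThreeFixAction G Ω) (ω : Ω) {p k : ℕ} [Fact p.Prime]
    (hc : Nat.card (MulAction.stabilizer G ω) = p ^ k) (hN : ¬ p ∣ Nat.card Ω) :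
    ∃ P : Sylow p G, ActsAsOnCosets G Ω (P : Subgroup G) := by
  have := h.transitive
  exact ⟨(IsPGroup.of_card hc).toSylow (by rwa [MulAction.index_stabilizer_of_transitive]),
    h.actsAsOnCosets ω⟩

theorem card_mem_admissibleDegrees [Finite G] (h : IsThreeFixAction G Ω) :
    Nat.card Ω ∈ admissibleDegrees (Nat.card G) := by
  obtain ⟨ω, -⟩ := h.nonregular
  obtain ⟨p, hp, hpd, hpN⟩ := h.exists_prime ω
  have h5 := h.five_le_card
  have hm := h.card_mul ω
  have hpos : 0 < Nat.card (MulAction.stabilizer G ω) := Nat.card_pos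
  have hdiv : Nat.card G / Nat.card Ω = Nat.card (MulAction.stabilizer G ω) := by
    rw [← hm, Nat.mul_div_cancel_left _ (by omega)]
  rw [admissibleDegrees, Finset.mem_filter, Finset.mem_Icc, hdiv]
  refine ⟨⟨h5, ?_⟩, ⟨_, hm.symm⟩, p, ?_, hpd, hpN⟩
  · rw [← hm]
    exact Nat.le_mul_of_pos_right _ hpos
  · exact Finset.mem_Icc.2 ⟨hp.two_le, Nat.le_of_dvd hpos hpd⟩

section Permutation

variable {n : ℕ} (φ : G →* Perm (Fin n))

theorem card_map_stabilizer (hφ : Function.Injective φ) (ω : Ω) :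
    Nat.card ((MulAction.stabilizer G ω).map φ) = Nat.card (MulAction.stabilizer G ω) :=
  (Nat.card_congr ((MulAction.stabilizer G ω).equivMapOfInjective φ hφ).toEquiv).symm

theorem map_stabilizer_ne_bot (h : IsThreeFixAction G Ω) (hφ : Function.Injective φ) (ω : Ω) :
    (MulAction.stabilizer G ω).map φ ≠ ⊥ := by
  rw [Ne, Subgroup.map_eq_bot_iff_of_injective _ hφ]
  exact h.stabilizer_ne_bot ω

end Permutation

theorem degree_lt_seven_of_symmetric (h : IsThreeFixAction G Ω) {n : ℕ}
    (ψ : G ≃* Perm (Fin n)) : n < 7 := by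
  by_contra! hn
  obtain ⟨ω, -⟩ := h.nonregular
  have hφ : Function.Injective ψ.toMonoidHom := ψ.injective
  have hT := h.atMostThree hφ ω
  rw [MonoidHom.range_eq_top.2 ψ.surjective] at hT
  rcases hT.card_eq_or_of_seven_le (fun _ _ => Subgroup.mem_top _) (by simpa using hn)
    (h.map_stabilizer_ne_bot _ hφ ω) (h.not_alternatingGroup_le (by omega) hφ ω) with
    ⟨-, h7⟩ | ⟨h7, ⟨x, hx, hx2⟩, h3⟩
  · exact hT.card_ne_seven hn h7
  · rw [Fintype.card_fin] at h7
    subst h7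
    exact hT.not_cycleType_two_two h3 hx hx2

theorem card_of_mulEquiv_alternatingGroup {n m : ℕ} (hn : 2 ≤ n)
    (ψ : G ≃* alternatingGroup (Fin n)) (hm : 2 * m = n.factorial) : Nat.card G = m := by
  have : Nontrivial (Fin n) := Fin.nontrivial_iff_two_le.2 hn
  have key := two_mul_nat_card_alternatingGroup (α := Fin n)
  rw [Nat.card_perm, Nat.card_eq_fintype_card (α := Fin n), Fintype.card_fin] at key
  rw [Nat.card_congr ψ.toEquiv]
  omega

theorem alternating_of_seven_le (h : IsThreeFixAction G Ω) {n : ℕ} (hn : 7 ≤ n)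
    (ψ : G ≃* alternatingGroup (Fin n)) :
    (n = 7 ∧ Nat.card Ω = 15 ∧ ∃ H : Subgroup G,
      Nonempty (H ≃* Matrix.ProjectiveSpecialLinearGroup (Fin 2) (ZMod 7)) ∧
      ActsAsOnCosets G Ω H) ∨
    (n = 7 ∧ Nat.card Ω = 360 ∧ ∃ P : Sylow 7 G, ActsAsOnCosets G Ω (P : Subgroup G)) ∨
    (n = 8 ∧ Nat.card Ω = 2880 ∧ ∃ P : Sylow 7 G, ActsAsOnCosets G Ω (P : Subgroup G)) := by
  obtain ⟨ω, -⟩ := h.nonregular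
  have : Finite G := Finite.of_equiv _ ψ.symm.toEquiv
  have : Fact (Nat.Prime 7) := ⟨by norm_num⟩
  let φ : G →* Perm (Fin n) := (alternatingGroup (Fin n)).subtype.comp ψ.toMonoidHom
  have hφ : Function.Injective φ := Subtype.val_injective.comp ψ.injective
  have hΓ : ∀ σ, sign σ = 1 → σ ∈ φ.range := fun σ hσ =>
    ⟨ψ.symm ⟨σ, mem_alternatingGroup.2 hσ⟩, by simp [φ]⟩
  have hT := h.atMostThree hφ ω
  have hmul := h.card_mul ω
  have hc := card_map_stabilizer φ hφ ω
  rcases hT.card_eq_or_of_seven_le hΓ (by simpa using hn) (h.map_stabilizer_ne_bot _ hφ ω)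
    (h.not_alternatingGroup_le (by omega) hφ ω) with ⟨h8, h7⟩ | ⟨h7, ⟨x, hx, hx2⟩, h3⟩
  · rw [Fintype.card_fin] at h8
    rw [h7] at hc
    rw [← hc] at hmul
    rcases (by omega : n = 7 ∨ n = 8) with rfl | rfl
    · rw [card_of_mulEquiv_alternatingGroup (by norm_num) ψ (m := 2520) rfl] at hmul
      have hN : Nat.card Ω = 360 := by omega
      exact Or.inr (Or.inl ⟨rfl, hN, h.exists_sylow ω (k := 1) hc.symm (by rw [hN]; norm_num)⟩)
    · rw [card_of_mulEquiv_alternatingGroup (by norm_num) ψ (m := 20160) rfl] at hmul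
      have hN : Nat.card Ω = 2880 := by omega
      exact Or.inr (Or.inr ⟨rfl, hN, h.exists_sylow ω (k := 1) hc.symm (by rw [hN]; norm_num)⟩)
  · rw [Fintype.card_fin] at h7
    subst h7
    have hG := card_of_mulEquiv_alternatingGroup (by norm_num) ψ (m := 2520) rfl
    obtain ⟨⟨k, hk⟩, hpsl⟩ := hT.psl_of_cycleType_two_two hΓ h3 hx hx2
    -- With `|H| = 168 * k` the order 2520 gives `|Ω| * k = 15`; faithfulness makes 7 divide `|Ω|!`,
    -- which leaves `k = 1`.
    have h7N : 7 ≤ Nat.card Ω := by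
      rw [← (by norm_num : Nat.Prime 7).dvd_factorial]
      exact Dvd.dvd.trans (by rw [hG]; norm_num) h.card_dvd_factorial
    rw [← hc, hk, hG] at hmul
    have hk1 : k = 1 := by
      have hk2 : Nat.card Ω * k = 15 := by linarith
      have hk0 : k ≠ 0 := by rintro rfl; omega
      have : k ≤ 2 := by nlinarith
      interval_cases k <;> omega
    subst hk1
    obtain ⟨e⟩ := hpsl hk
    exact Or.inl ⟨rfl, by omega, _,
      ⟨((MulAction.stabilizer G ω).equivMapOfInjective φ hφ).trans e⟩, h.actsAsOnCosets ω⟩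

section Natural

variable [Finite G]

/-- The permutation representation in terms of a numbering of the points. -/
theorem exists_hom (h : IsThreeFixAction G Ω) {n : ℕ} (hn : Nat.card Ω = n) :
    ∃ (ρ : G →* Perm (Fin n)) (e : Ω ≃ Fin n), Function.Injective ρ ∧
      ∀ (g : G) (x : Ω), e (g • x) = ρ g (e x) := by
  have := h.finite
  have := h.faithful
  let e := Finite.equivFinOfCardEq hn
  refine ⟨e.permCongrHom.toMonoidHom.comp (MulAction.toPermHom G Ω), e,
    e.permCongrHom.injective.comp MulAction.toPerm_injective, fun g x => ?_⟩
  change _ = e (g • e.symm (e x))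
  rw [e.symm_apply_apply]

theorem actsAsNaturalSymmetric (h : IsThreeFixAction G Ω) {n : ℕ} (hn : Nat.card Ω = n)
    (hG : Nat.card G = n.factorial) : ActsAsNaturalSymmetric n G Ω := by
  obtain ⟨ρ, e, hρ, he⟩ := h.exists_hom hn
  have hb : Function.Bijective ρ := (Nat.bijective_iff_injective_and_card ρ).2 ⟨hρ, by
    rw [hG, Nat.card_perm, Nat.card_eq_fintype_card, Fintype.card_fin]⟩
  exact ⟨MulEquiv.ofBijective ρ hb, e, he⟩

theorem actsAsNaturalAlternating (h : IsThreeFixAction G Ω) {n : ℕ} (hn : Nat.card Ω = n)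
    (hG : 2 * Nat.card G = n.factorial) : ActsAsNaturalAlternating n G Ω := by
  obtain ⟨ρ, e, hρ, he⟩ := h.exists_hom hn
  have hr : ρ.range = alternatingGroup (Fin n) := by
    apply eq_alternatingGroup_of_index_eq_two
    have h1 := Subgroup.card_mul_index ρ.range
    rw [Nat.card_perm, Nat.card_eq_fintype_card (α := Fin n), Fintype.card_fin, ← hG,
      ← Nat.card_congr (MonoidHom.ofInjective hρ).toEquiv, mul_comm] at h1
    exact Nat.eq_of_mul_eq_mul_right Nat.card_pos h1
  exact ⟨(MonoidHom.ofInjective hρ).trans (MulEquiv.subgroupCongr hr), e, he⟩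

end Natural

theorem five_le_of_alternating (h : IsThreeFixAction G Ω) {n : ℕ}
    (ψ : G ≃* alternatingGroup (Fin n)) : 5 ≤ n := by
  by_contra! hn
  have : Finite G := Finite.of_equiv _ ψ.symm.toEquiv
  have key := h.card_mem_admissibleDegrees
  have h1 : ∀ m, (∀ N, N ∉ admissibleDegrees m) → Nat.card G ≠ m := by
    rintro m hm rfl
    exact hm _ key
  have e : ∀ m, m = 1 ∨ m = 3 ∨ m = 12 → admissibleDegrees m = ∅ := by
    rintro m (rfl | rfl | rfl) <;> decide +kernel
  have h2 : ∀ m, m = 1 ∨ m = 3 ∨ m = 12 → Nat.card G ≠ m := fun m hm =>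
    h1 m (fun N => by rw [e m hm]; exact Finset.notMem_empty N)
  interval_cases n
  · exact h2 1 (by tauto) (by
      rw [Nat.card_congr ψ.toEquiv, Nat.card_eq_fintype_card]; decide)
  · exact h2 1 (by tauto) (by
      rw [Nat.card_congr ψ.toEquiv, Nat.card_eq_fintype_card]; decide)
  · exact h2 1 (by tauto) (card_of_mulEquiv_alternatingGroup (by norm_num) ψ rfl)
  · exact h2 3 (by tauto) (card_of_mulEquiv_alternatingGroup (by norm_num) ψ rfl)
  · exact h2 12 (by tauto) (card_of_mulEquiv_alternatingGroup (by norm_num) ψ rfl)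

theorem card_of_mulEquiv_perm {n : ℕ} (ψ : G ≃* Perm (Fin n)) : Nat.card G = n.factorial := by
  rw [Nat.card_congr ψ.toEquiv, Nat.card_perm, Nat.card_eq_fintype_card, Fintype.card_fin]

theorem five_le_of_symmetric (h : IsThreeFixAction G Ω) {n : ℕ} (ψ : G ≃* Perm (Fin n)) :
    5 ≤ n := by
  by_contra! hn
  have : Finite G := Finite.of_equiv _ ψ.symm.toEquiv
  have key := h.card_mem_admissibleDegrees
  rw [card_of_mulEquiv_perm ψ] at key
  have e : ∀ n < 5, admissibleDegrees n.factorial = ∅ := by decide +kernel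
  rw [e n hn] at key
  exact Finset.notMem_empty _ key

/-- Arithmetic leaves degrees 5 and 15. In degree 5 an element with exactly three fixed points would
be a transposition, which is odd. -/
theorem alternating_five (h : IsThreeFixAction G Ω) (ψ : G ≃* alternatingGroup (Fin 5)) :
    Nat.card Ω = 15 ∧ ∃ P : Sylow 2 G, ActsAsOnCosets G Ω (P : Subgroup G) := by
  obtain ⟨ω, -⟩ := h.nonregular
  have : Finite G := Finite.of_equiv _ ψ.symm.toEquiv
  have hG : Nat.card G = 60 := card_of_mulEquiv_alternatingGroup (by norm_num) ψ rfl
  have key := h.card_mem_admissibleDegrees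
  have hmul := h.card_mul ω
  rw [hG] at key hmul
  rw [show admissibleDegrees 60 = {5, 15} by decide +kernel, Finset.mem_insert,
    Finset.mem_singleton] at key
  rcases key with hN | hN
  · obtain ⟨φ, e, he⟩ := h.actsAsNaturalAlternating hN (by rw [hG]; rfl)
    obtain ⟨g, -, hg⟩ := h.exists_fixCard_eq_three
    have key : ∀ σ : Perm (Fin 5), sign σ = 1 → Fintype.card {i // σ i = i} ≠ 3 := by
      decide +kernel
    refine absurd ?_ (key (φ g) (mem_alternatingGroup.1 (φ g).2))
    rw [← Nat.card_eq_fintype_card, ← hg]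
    refine (Nat.card_congr (e.subtypeEquiv fun x => ?_)).symm
    rw [← he, e.apply_eq_iff_eq]
    exact MulAction.mem_fixedBy
  · rw [hN] at hmul
    exact ⟨hN, h.exists_sylow ω (k := 2) (by omega) (by rw [hN]; norm_num)⟩

set_option maxRecDepth 4000 in
theorem symmetric_five (h : IsThreeFixAction G Ω) (ψ : G ≃* Perm (Fin 5)) :
    (Nat.card Ω = 15 ∧ ∃ P : Sylow 2 G, ActsAsOnCosets G Ω (P : Subgroup G)) ∨
      Nat.card Ω = 5 ∧ ActsAsNaturalSymmetric 5 G Ω := by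
  obtain ⟨ω, -⟩ := h.nonregular
  have : Finite G := Finite.of_equiv _ ψ.symm.toEquiv
  have hG : Nat.card G = 120 := card_of_mulEquiv_perm ψ
  have key := h.card_mem_admissibleDegrees
  have hmul := h.card_mul ω
  rw [hG] at key hmul
  rw [show admissibleDegrees 120 = {5, 8, 15} by decide +kernel, Finset.mem_insert,
    Finset.mem_insert, Finset.mem_singleton] at key
  rcases key with hN | hN | hN
  · exact Or.inr ⟨hN, h.actsAsNaturalSymmetric hN (by rw [hG]; rfl)⟩
  -- In degree 8 the stabilizer has order 15 and contains a five-cycle. A four-cycle normalizes it,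
  -- so `pow_mem_or` puts a nontrivial 2-element into a group of odd order.
  · exfalso
    rw [hN] at hmul
    have hφ : Function.Injective ψ.toMonoidHom := ψ.injective
    have hT := h.atMostThree hφ ω
    rw [MonoidHom.range_eq_top.2 ψ.surjective] at hT
    have hc := card_map_stabilizer ψ.toMonoidHom hφ ω
    set H := (MulAction.stabilizer G ω).map ψ.toMonoidHom
    have hH : Nat.card H = 15 := by omega
    have e : ∀ x : Perm (Fin 5), x ^ 5 = 1 → x ≠ 1 →
        x.cycleType = (c[0, 1, 2, 3, 4] : Perm (Fin 5)).cycleType := by decide +kernel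
    have : Fact (Nat.Prime 5) := ⟨by norm_num⟩
    obtain ⟨⟨x, hx⟩, hxp⟩ := exists_prime_orderOf_dvd_card' (G := H) 5 (by rw [hH]; norm_num)
    rw [Subgroup.orderOf_mk] at hxp
    obtain ⟨ρ, hρ⟩ := AtMostThree.exists_relabel_mem hx (e x (orderOf_dvd_iff_pow_eq_one.1 hxp.dvd) (by
      rintro rfl; rw [orderOf_one] at hxp; omega))
    have key : ∀ σ : Perm (Fin 5), σ ≠ 1 ∧ σ ^ 4 = 1 →
        σ ∉ H.comap (MulAut.conj ρ).toMonoidHom := by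
      rintro σ ⟨h1, h4⟩ hσ
      have hd := Subgroup.orderOf_dvd_natCard H (AtMostThree.mem_relabel.1 hσ)
      rw [← MulAut.conj_apply, MulEquiv.orderOf_eq, hH] at hd
      have := Nat.dvd_gcd hd (orderOf_dvd_of_pow_eq_one h4)
      exact h1 (orderOf_eq_one_iff.1 (Nat.dvd_one.1 this))
    rcases (hT.relabel ρ).pow_mem_or (u := c[1, 2, 4, 3]) hρ (by decide) (Subgroup.mem_top _) 3
      (by decide) with hq | hq | hq
    all_goals exact key _ (by decide) hq
  · rw [hN] at hmul
    exact Or.inl ⟨hN, h.exists_sylow ω (k := 3) (by omega) (by rw [hN]; norm_num)⟩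

end IsThreeFixAction

/-! ### Degree six: fixed-point counts by cycle type -/

/-- The cycle types in degree six with the numbers of permutations having them. -/
def sixTypes : List (Multiset ℕ × ℕ) :=
  [(0, 1), ({2}, 15), ({2, 2}, 45), ({2, 2, 2}, 15), ({3}, 40), ({3, 3}, 40), ({4}, 90),
    ({4, 2}, 90), ({5}, 144), ({6}, 120), ({3, 2}, 120)]

/-- The even cycle types in degree six with the numbers of permutations having them. -/
def evenSixTypes : List (Multiset ℕ × ℕ) :=
  [(0, 1), ({2, 2}, 45), ({3}, 40), ({3, 3}, 40), ({4, 2}, 90), ({5}, 144)]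

theorem card_of_mem_sixTypes : ∀ x ∈ sixTypes,
    (Finset.univ.filter fun σ : Perm (Fin 6) => σ.cycleType = x.1).card = x.2 := by
  intro x hx
  rw [card_of_cycleType]
  revert x
  decide +kernel

theorem evenSixTypes_subset : ∀ x ∈ evenSixTypes, x ∈ sixTypes := by
  decide +kernel

theorem mem_sixTypes_of_sum_le (m : Multiset ℕ) (h2 : ∀ a ∈ m, 2 ≤ a) (h : m.sum ≤ 6) :
    m ∈ sixTypes.map Prod.fst := by
  have hc : m.card ≤ 3 := by
    have := Multiset.card_nsmul_le_sum h2
    rw [smul_eq_mul] at this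
    omega
  obtain h0 | h0 | h0 | h0 : m.card = 0 ∨ m.card = 1 ∨ m.card = 2 ∨ m.card = 3 := by omega
  · rw [Multiset.card_eq_zero.1 h0]; decide
  · obtain ⟨a, rfl⟩ := Multiset.card_eq_one.1 h0
    simp only [Multiset.mem_singleton, forall_eq, Multiset.sum_singleton] at h2 h
    interval_cases a <;> decide
  · obtain ⟨a, b, rfl⟩ := Multiset.card_eq_two.1 h0
    simp at h2 h
    have : a ≤ 4 := by omega
    have : b ≤ 4 := by omega
    obtain ⟨h2, h3⟩ := h2
    interval_cases a <;> interval_cases b <;> first | omega | decide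
  · obtain ⟨a, b, c, rfl⟩ := Multiset.card_eq_three.1 h0
    simp at h2 h
    obtain rfl : a = 2 := by omega
    obtain rfl : b = 2 := by omega
    obtain rfl : c = 2 := by omega
    decide

theorem cycleType_mem_sixTypes (σ : Perm (Fin 6)) : σ.cycleType ∈ sixTypes.map Prod.fst :=
  mem_sixTypes_of_sum_le _ (fun _ ha => two_le_of_mem_cycleType ha)
    (σ.sum_cycleType_le.trans (by simp))

theorem cycleType_mem_evenSixTypes {σ : Perm (Fin 6)} (hσ : sign σ = 1) :
    σ.cycleType ∈ evenSixTypes.map Prod.fst := by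
  have key : ∀ m ∈ sixTypes.map Prod.fst, (-1 : ℤˣ) ^ (m.sum + m.card) = 1 →
      m ∈ evenSixTypes.map Prod.fst := by decide +kernel
  exact key _ (cycleType_mem_sixTypes σ) (by rw [← sign_of_cycleType, hσ])

theorem sign_eq_one_of_mem_evenSixTypes {σ : Perm (Fin 6)}
    (hσ : σ.cycleType ∈ evenSixTypes.map Prod.fst) : sign σ = 1 := by
  have key : ∀ m ∈ evenSixTypes.map Prod.fst, (-1 : ℤˣ) ^ (m.sum + m.card) = 1 := by
    decide +kernel
  rw [sign_of_cycleType, key _ hσ]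

/-- The possible numbers of fixed points of an element of order `o`, when stabilizers have order
`h` and the number is congruent to `m` modulo `r`. -/
def fixCandidates (h o r m : ℕ) : Finset ℕ :=
  (Finset.range 4).filter fun a => a % r = m % r ∧ (a = 0 ∨ o ∣ h)

theorem mem_fixCandidates {h o r m a : ℕ} :
    a ∈ fixCandidates h o r m ↔ a < 4 ∧ a % r = m % r ∧ (a = 0 ∨ o ∣ h) := by
  rw [fixCandidates, Finset.mem_filter, Finset.mem_range]

set_option maxRecDepth 4000 in
set_option synthInstance.maxHeartbeats 400000 in
set_option synthInstance.maxSize 1000 in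
-- The letters `a, b, c, d, e, f, g, p, i, j` are the fixed-point counts for the types `{2}`,
-- `{2,2}`, `{2,2,2}`, `{3}`, `{3,3}`, `{4}`, `{4,2}`, `{5}`, `{6}`, `{3,2}`. Elements of composite
-- order are compared with their squares and cubes, and the long equation is Burnside's lemma.
theorem symmetric_six_numeric : ∀ N ∈ (Finset.Icc 6 720).filter (· ∣ 720),
    ∀ a ∈ fixCandidates (720 / N) 2 2 N,
    ∀ b ∈ fixCandidates (720 / N) 2 2 N,
    ∀ c ∈ fixCandidates (720 / N) 2 2 N,
    ∀ d ∈ fixCandidates (720 / N) 3 3 N,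
    ∀ e ∈ fixCandidates (720 / N) 3 3 N,
    ∀ f ∈ fixCandidates (720 / N) 4 2 b, f ≤ b →
    ∀ g ∈ fixCandidates (720 / N) 4 2 b, g ≤ b →
    ∀ p ∈ fixCandidates (720 / N) 5 5 N,
    ∀ i ∈ fixCandidates (720 / N) 6 2 e, i ≤ e ∧ i ≤ c ∧ i % 3 = c % 3 →
    ∀ j ∈ fixCandidates (720 / N) 6 2 d, j ≤ d ∧ j ≤ a ∧ j % 3 = a % 3 →
    N + 15 * a + 45 * b + 15 * c + 40 * d + 40 * e + 90 * f + 90 * g + 144 * p +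
      120 * i + 120 * j = 720 →
    3 ∈ [a, b, c, d, e, f, g, p, i, j] →
    a = 0 ∧ b ≠ 0 ∧ c = 0 ∧ d = 0 := by decide +kernel
theorem alternating_six_numeric : ∀ N ∈ (Finset.Icc 6 360).filter (· ∣ 360),
    ∀ b ∈ fixCandidates (360 / N) 2 2 N,
    ∀ d ∈ fixCandidates (360 / N) 3 3 N,
    ∀ e ∈ fixCandidates (360 / N) 3 3 N, d = 0 ∨ e = 0 ∨ 9 ∣ 360 / N →
    ∀ g ∈ fixCandidates (360 / N) 4 2 b, g ≤ b →
    ∀ p ∈ fixCandidates (360 / N) 5 5 N,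
    N + 45 * b + 40 * d + 40 * e + 90 * g + 144 * p = 360 →
    3 ∈ [b, d, e, g, p] →
    N = 6 ∨ N = 15 := by decide +kernel

namespace IsThreeFixAction

section ClassFunction

variable {G Ω : Type*} [Group G] [MulAction G Ω]

theorem exists_classFunction {n : ℕ} (φ : G →* Perm (Fin n))
    (hF : ∀ g k, (φ g).cycleType = (φ k).cycleType → fixCard Ω g = fixCard Ω k) :
    ∃ f : Multiset ℕ → ℕ, ∀ g, fixCard Ω g = f (φ g).cycleType := by
  have hft : Function.FactorsThrough (fixCard Ω) fun g => (φ g).cycleType := fun g k => hF g k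
  exact ⟨Function.extend (fun g => (φ g).cycleType) (fixCard Ω) 0,
    fun g => (hft.extend_apply 0 g).symm⟩

variable {n : ℕ} {φ : G →* Perm (Fin n)} {f : Multiset ℕ → ℕ}

theorem classFunction_zero (hf : ∀ g, fixCard Ω g = f (φ g).cycleType) : f 0 = Nat.card Ω := by
  rw [← fixCard_one (G := G), hf 1, map_one, cycleType_one]

variable [Finite G]

theorem classFunction_mem (h : IsThreeFixAction G Ω) (hφ : Function.Injective φ)
    (hf : ∀ g, fixCard Ω g = f (φ g).cycleType) {p o : ℕ} (hp : p.Prime) {m m' : Multiset ℕ}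
    {σ : Perm (Fin n)} (hσ : σ ∈ φ.range) (hm : σ.cycleType = m) (hm' : (σ ^ p).cycleType = m')
    (ho : m.lcm = o) (hm0 : m ≠ 0) :
    f m ∈ fixCandidates (Nat.card G / Nat.card Ω) o p (f m') ∧ f m ≤ f m' := by
  obtain ⟨g, rfl⟩ := hσ
  rw [← map_pow] at hm'
  obtain ⟨ω, -⟩ := h.nonregular
  have := h.five_le_card
  rw [mem_fixCandidates, ← h.card_mul ω, Nat.mul_div_cancel_left _ (by omega), ← hm, ← hm',
    ← hf, ← hf]
  refine ⟨⟨Nat.lt_succ_of_le (h.fixCard_le_three ?_), (h.fixCard_modEq g hp).symm, ?_⟩,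
    h.fixCard_le_pow g p⟩
  · rintro rfl
    rw [map_one, cycleType_one] at hm
    exact hm0 hm.symm
  · refine or_iff_not_imp_left.2 fun h0 => ?_
    have := h.orderOf_dvd ω h0
    rwa [← orderOf_injective φ hφ, ← lcm_cycleType, hm, ho] at this

theorem exists_classFunction_eq_three (h : IsThreeFixAction G Ω)
    (hf : ∀ g, fixCard Ω g = f (φ g).cycleType) : ∃ g, f (φ g).cycleType = 3 := by
  obtain ⟨g, -, hg⟩ := h.exists_fixCard_eq_three
  exact ⟨g, by rw [← hf, hg]⟩

/-- Burnside's lemma for one orbit, with the sum grouped by cycle type. -/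
theorem sum_classFunction (h : IsThreeFixAction G Ω) (hφ : Function.Injective φ)
    (hf : ∀ g, fixCard Ω g = f (φ g).cycleType) {l : List (Multiset ℕ × ℕ)}
    (hl : (l.map Prod.fst).Nodup) (hr : ∀ σ, σ ∈ φ.range ↔ σ.cycleType ∈ l.map Prod.fst)
    (hc : ∀ x ∈ l, (Finset.univ.filter fun σ : Perm (Fin n) => σ.cycleType = x.1).card = x.2) :
    (l.map fun x => x.2 * f x.1).sum = Nat.card G := by
  classical
  have := Fintype.ofFinite G
  have h1 : ∑ g : G, f (φ g).cycleType = Nat.card G := by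
    rw [← h.sum_fixCard]
    exact Finset.sum_congr rfl fun g _ => (hf g).symm
  have h2 : ∑ g : G, f (φ g).cycleType =
      ∑ σ : Perm (Fin n) with σ.cycleType ∈ (l.map Prod.fst).toFinset, f σ.cycleType := by
    refine Finset.sum_bij (fun g _ => φ g) (fun g _ => ?_) (fun g _ k _ hgk => hφ hgk)
      (fun σ hσ => ?_) fun g _ => rfl
    · rw [Finset.mem_filter, List.mem_toFinset, ← hr]
      exact ⟨Finset.mem_univ _, g, rfl⟩
    · rw [Finset.mem_filter, List.mem_toFinset, ← hr] at hσ
      obtain ⟨-, g, hg⟩ := hσ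
      exact ⟨g, Finset.mem_univ _, hg⟩
  rw [← h1, h2, ← Finset.sum_fiberwise_of_maps_to (g := fun σ : Perm (Fin n) => σ.cycleType)
    (t := (l.map Prod.fst).toFinset) (fun σ hσ => (Finset.mem_filter.1 hσ).2),
    List.sum_toFinset _ hl, List.map_map]
  congr 1
  refine List.map_congr_left fun x hx => ?_
  have hx' : x.1 ∈ (l.map Prod.fst).toFinset :=
    List.mem_toFinset.2 (List.mem_map_of_mem hx)
  rw [Function.comp_apply, ← hc x hx, Finset.filter_filter, ← smul_eq_mul, ← Finset.sum_const]
  refine Finset.sum_congr ?_ fun σ hσ => by rw [(Finset.mem_filter.1 hσ).2.2]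
  ext σ
  simp only [Finset.mem_filter, Finset.mem_univ, true_and]
  exact ⟨fun h0 => ⟨h0 ▸ hx', h0⟩, fun h0 => h0.2⟩

end ClassFunction

end IsThreeFixAction

namespace IsThreeFixAction

variable {G Ω : Type*} [Group G] [MulAction G Ω]

theorem six_le_card [Finite G] (h : IsThreeFixAction G Ω) (hG : 360 ∣ Nat.card G) :
    6 ≤ Nat.card Ω := by
  by_contra! h6
  have h5 := h.five_le_card
  have := hG.trans h.card_dvd_factorial
  rw [show Nat.card Ω = 5 by omega] at this
  revert this
  decide

theorem card_mem_filter_dvd [Finite G] (h : IsThreeFixAction G Ω) (hG : 360 ∣ Nat.card G) :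
    Nat.card Ω ∈ (Finset.Icc 6 (Nat.card G)).filter (· ∣ Nat.card G) := by
  obtain ⟨ω, -⟩ := h.nonregular
  have hd : Nat.card Ω ∣ Nat.card G := ⟨_, (h.card_mul ω).symm⟩
  exact Finset.mem_filter.2 ⟨Finset.mem_Icc.2 ⟨h.six_le_card hG, Nat.le_of_dvd Nat.card_pos hd⟩, hd⟩

set_option maxRecDepth 4000 in
-- The numerical search forces double transpositions to have fixed points, but transpositions,
-- triple transpositions and three-cycles to have none. Klein four-groups centralizing a double
-- transposition in `H` then put two more into `H` whose product is a three-cycle.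
theorem not_symmetric_six (h : IsThreeFixAction G Ω) (ψ : G ≃* Perm (Fin 6)) : False := by
  have : Finite G := Finite.of_equiv _ ψ.symm.toEquiv
  have hG : Nat.card G = 720 := card_of_mulEquiv_perm ψ
  have hφ : Function.Injective ψ.toMonoidHom := ψ.injective
  have hΓ : ψ.toMonoidHom.range = ⊤ := MonoidHom.range_eq_top.2 ψ.surjective
  have hr : ∀ σ, σ ∈ ψ.toMonoidHom.range := fun σ => hΓ ▸ Subgroup.mem_top σ
  obtain ⟨f, hf⟩ := exists_classFunction (Ω := Ω) ψ.toMonoidHom fun g k hgk => by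
    obtain ⟨c, hc⟩ := isConj_iff.1 (isConj_iff_cycleType_eq.2 hgk)
    obtain ⟨c, rfl⟩ := ψ.surjective c
    rw [← fixCard_conj g c]
    congr 1
    exact ψ.injective (by simpa using hc)
  have h0 := classFunction_zero hf
  have hsum := h.sum_classFunction hφ hf (l := sixTypes) (by decide +kernel)
    (fun σ => iff_of_true (hr σ) (cycleType_mem_sixTypes σ)) card_of_mem_sixTypes
  obtain ⟨g, hg⟩ := h.exists_classFunction_eq_three hf
  have hgT := cycleType_mem_sixTypes (ψ.toMonoidHom g)
  have hN := h.card_mem_filter_dvd (by rw [hG]; norm_num)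
  -- This excludes the identity as the element with three fixed points.
  have h6 := h.six_le_card (by rw [hG]; norm_num)
  have ha := h.classFunction_mem hφ hf (p := 2) Nat.prime_two (hr c[0, 1]) (m := {2}) (m' := 0)
    (by decide) (by decide) rfl (by decide)
  have hb := h.classFunction_mem hφ hf (p := 2) Nat.prime_two (hr (c[0, 1] * c[2, 3]))
    (m := {2, 2}) (m' := 0) (by decide) (by decide) rfl (by decide)
  have hc := h.classFunction_mem hφ hf (p := 2) Nat.prime_two (hr (c[0, 1] * c[2, 3] * c[4, 5]))
    (m := {2, 2, 2}) (m' := 0) (by decide) (by decide) rfl (by decide)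
  have hd := h.classFunction_mem hφ hf (p := 3) Nat.prime_three (hr c[0, 1, 2])
    (m := {3}) (m' := 0) (by decide) (by decide) rfl (by decide)
  have he := h.classFunction_mem hφ hf (p := 3) Nat.prime_three (hr (c[0, 1, 2] * c[3, 4, 5]))
    (m := {3, 3}) (m' := 0) (by decide) (by decide) rfl (by decide)
  have hf4 := h.classFunction_mem hφ hf (p := 2) Nat.prime_two (hr c[0, 1, 2, 3])
    (m := {4}) (m' := {2, 2}) (by decide) (by decide) rfl (by decide)
  have hg4 := h.classFunction_mem hφ hf (p := 2) Nat.prime_two (hr (c[0, 1, 2, 3] * c[4, 5]))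
    (m := {4, 2}) (m' := {2, 2}) (by decide) (by decide) rfl (by decide)
  have hp := h.classFunction_mem hφ hf (p := 5) Nat.prime_five (hr c[0, 1, 2, 3, 4])
    (m := {5}) (m' := 0) (by decide) (by decide) rfl (by decide)
  have hi := h.classFunction_mem hφ hf (p := 2) Nat.prime_two (hr c[0, 1, 2, 3, 4, 5])
    (m := {6}) (m' := {3, 3}) (by decide) (by decide) rfl (by decide)
  have hi3 := h.classFunction_mem hφ hf (p := 3) Nat.prime_three (hr c[0, 1, 2, 3, 4, 5])
    (m := {6}) (m' := {2, 2, 2}) (by decide) (by decide) rfl (by decide)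
  have hj := h.classFunction_mem hφ hf (p := 2) Nat.prime_two (hr (c[0, 1, 2] * c[3, 4]))
    (m := {3, 2}) (m' := {3}) (by decide) (by decide) rfl (by decide)
  have hj3 := h.classFunction_mem hφ hf (p := 3) Nat.prime_three (hr (c[0, 1, 2] * c[3, 4]))
    (m := {3, 2}) (m' := {2}) (by decide) (by decide) rfl (by decide)
  rw [hG, h0] at ha hb hc hd he hp
  rw [hG] at hf4 hg4 hi hj hi3 hj3 hN hsum
  simp only [sixTypes, List.map_cons, List.map_nil, List.sum_cons, List.sum_nil, h0] at hsum
  simp only [sixTypes, List.map_cons, List.map_nil, List.mem_cons, List.not_mem_nil] at hgT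
  obtain ⟨ha0, hb0, hc0, hd0⟩ := symmetric_six_numeric _ hN _ ha.1 _ hb.1 _ hc.1 _ hd.1 _ he.1
    _ hf4.1 hf4.2 _ hg4.1 hg4.2 _ hp.1 _ hi.1 ⟨hi.2, hi3.2, (mem_fixCandidates.1 hi3.1).2.1⟩
    _ hj.1 ⟨hj.2, hj3.2, (mem_fixCandidates.1 hj3.1).2.1⟩ (by omega) (by
      rcases hgT with hm | hm | hm | hm | hm | hm | hm | hm | hm | hm | hm | hm <;>
        first
        | exact hm.elim
        | (rw [hm] at hg; first | (simp only [hg, List.mem_cons, true_or, or_true]; done) | omega))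
  have hfix : ∀ g : G, (ψ g).cycleType = {2, 2} → fixCard Ω g ≠ 0 := fun g hg => by
    rw [hf g]
    exact hg ▸ hb0
  have := h.finite
  obtain ⟨⟨⟨ω, hω⟩⟩⟩ := Nat.card_pos_iff.1 (Nat.pos_of_ne_zero
    (hfix (ψ.symm (c[0, 1] * c[2, 3])) (by rw [ψ.apply_symm_apply]; decide)))
  have hT := h.atMostThree hφ ω
  rw [hΓ] at hT
  set H := (MulAction.stabilizer G ω).map ψ.toMonoidHom with hH
  have hx : c[0, 1] * c[2, 3] ∈ H := ⟨_, hω, ψ.apply_symm_apply _⟩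
  have hnot : ∀ σ ∈ H, f σ.cycleType ≠ 0 := by
    rintro _ ⟨g, hg, rfl⟩
    rw [← hf]
    exact (Nat.card_pos_iff.2 ⟨⟨⟨ω, hg⟩⟩, inferInstance⟩).ne'
  have h2 : ∀ σ ∈ H, σ.cycleType ≠ {2} := fun σ hσ h0 => hnot σ hσ (h0 ▸ ha0)
  have h222 : ∀ σ ∈ H, σ.cycleType ≠ {2, 2, 2} := fun σ hσ h0 => hnot σ hσ (h0 ▸ hc0)
  have h3 : ∀ σ ∈ H, σ.cycleType ≠ {3} := fun σ hσ h0 => hnot σ hσ (h0 ▸ hd0)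
  have hy : c[0, 1] * c[4, 5] ∈ H := by
    rcases hT.klein hx (by decide) (a := c[0, 1]) (b := c[4, 5]) (Subgroup.mem_top _)
      (Subgroup.mem_top _) (by decide) (by decide) (by decide) (by decide) with hq | hq | hq
    · exact absurd (by decide) (h2 _ hq)
    · exact absurd (by decide) (h2 _ hq)
    · exact hq
  have hz : c[0, 2] * c[1, 3] ∈ H := by
    rcases hT.klein hx (by decide) (a := c[4, 5]) (b := c[0, 2] * c[1, 3] * c[4, 5])
      (Subgroup.mem_top _) (Subgroup.mem_top _) (by decide) (by decide) (by decide) (by decide)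
      with hq | hq | hq
    · exact absurd (by decide) (h2 _ hq)
    · exact absurd (by decide) (h222 _ hq)
    · exact mem_of_eq (by decide) hq
  have hw : c[0, 2] * c[4, 5] ∈ H := by
    rcases hT.klein hz (by decide) (a := c[0, 2]) (b := c[4, 5]) (Subgroup.mem_top _)
      (Subgroup.mem_top _) (by decide) (by decide) (by decide) (by decide) with hq | hq | hq
    · exact absurd (by decide) (h2 _ hq)
    · exact absurd (by decide) (h2 _ hq)
    · exact hq
  exact h3 _ (mul_mem hy hw) (by decide)

end IsThreeFixAction

/-- Subgroups of prime order `p` are conjugate if `p` divides the group order only once. -/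
theorem exists_conj_mem_zpowers {K : Type*} [Group K] [Finite K] {p : ℕ} [hp : Fact p.Prime]
    (hK : ¬ p ^ 2 ∣ Nat.card K) {x y : K} (hx : orderOf x = p) (hy : orderOf y = p) :
    ∃ k : K, k * y * k⁻¹ ∈ Subgroup.zpowers x := by
  have key : ∀ z : K, orderOf z = p → ∃ P : Sylow p K, (P : Subgroup K) = Subgroup.zpowers z := by
    intro z hz
    have hc : Nat.card (Subgroup.zpowers z) = p ^ 1 := by rw [Nat.card_zpowers, hz, pow_one]
    refine ⟨(IsPGroup.of_card hc).toSylow fun hd => hK ?_, rfl⟩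
    rw [← Subgroup.card_mul_index (Subgroup.zpowers z), hc, sq, pow_one]
    exact mul_dvd_mul_left p hd
  obtain ⟨P, hP⟩ := key x hx
  obtain ⟨Q, hQ⟩ := key y hy
  obtain ⟨k, hk⟩ := MulAction.exists_smul_eq K Q P
  refine ⟨k, ?_⟩
  rw [← hP, ← hk, Sylow.coe_subgroup_smul, hQ]
  exact Subgroup.smul_mem_pointwise_smul y (MulAut.conj k) _ (Subgroup.mem_zpowers y)

/-- Conjugate permutations, one of which commutes with an odd permutation, are conjugate under
an even permutation. -/
theorem exists_even_conj {α : Type*} [Fintype α] [DecidableEq α] {σ τ κ : Perm α}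
    (h : σ.cycleType = τ.cycleType) (hκ : sign κ = -1) (hc : κ * τ = τ * κ) :
    ∃ c, sign c = 1 ∧ c * τ * c⁻¹ = σ := by
  obtain ⟨c, hcτ⟩ := isConj_iff.1 (isConj_iff_cycleType_eq.2 h.symm)
  rcases Int.units_eq_one_or (sign c) with h1 | h1
  · exact ⟨c, h1, hcτ⟩
  · refine ⟨c * κ, by rw [map_mul, h1, hκ]; rfl, ?_⟩
    rw [← hcτ, mul_inv_rev, mul_assoc c, hc]
    group

namespace IsThreeFixAction

variable {G Ω : Type*} [Group G] [MulAction G Ω]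

/-- One stabilizer contains elements of both types. If 9 did not divide its order, its subgroups of
order 3 would be conjugate, yet the two types move different numbers of points. -/
theorem nine_dvd [Finite G] (h : IsThreeFixAction G Ω) {n : ℕ} {φ : G →* Perm (Fin n)}
    (hφ : Function.Injective φ) {g k : G} (hg : (φ g).cycleType = {3})
    (hk : (φ k).cycleType = {3, 3}) (hgΩ : fixCard Ω g ≠ 0) (hkΩ : fixCard Ω k ≠ 0) (ω : Ω) :
    9 ∣ Nat.card (MulAction.stabilizer G ω) := by
  have := h.finite
  have := h.transitive
  have : Fact (Nat.Prime 3) := ⟨Nat.prime_three⟩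
  obtain ⟨⟨a, ha⟩⟩ := (Nat.card_pos_iff.1 (Nat.pos_of_ne_zero hgΩ)).1
  obtain ⟨⟨b, hb⟩⟩ := (Nat.card_pos_iff.1 (Nat.pos_of_ne_zero hkΩ)).1
  obtain ⟨t, rfl⟩ := MulAction.exists_smul_eq G a b
  have hga : g ∈ MulAction.stabilizer G a := ha
  have hka : t⁻¹ * k * t ∈ MulAction.stabilizer G a := by
    rw [MulAction.mem_stabilizer_iff, mul_smul, mul_smul, inv_smul_eq_iff]
    exact hb
  rw [h.card_stabilizer_eq ω a]
  by_contra h9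
  have ho : ∀ z : G, (φ z).cycleType.lcm = 3 → orderOf z = 3 := fun z hz => by
    rwa [← orderOf_injective φ hφ, ← lcm_cycleType]
  have hk' : (φ (t⁻¹ * k * t)).cycleType = {3, 3} := by
    rw [← hk, map_mul, map_mul, map_inv]
    exact cycleType_conj (σ := φ k) (τ := (φ t)⁻¹)
  obtain ⟨⟨c, hc⟩, i, hi⟩ := exists_conj_mem_zpowers (p := 3) (x := ⟨g, hga⟩)
    (y := (⟨_, hka⟩ : MulAction.stabilizer G a)) h9
    (by rw [Subgroup.orderOf_mk]; exact ho _ (by rw [hg]; rfl))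
    (by rw [Subgroup.orderOf_mk]; exact ho _ (by rw [hk']; rfl))
  have hi' : φ g ^ i = φ c * φ (t⁻¹ * k * t) * (φ c)⁻¹ := by
    rw [← map_zpow, ← map_inv, ← map_mul, ← map_mul]
    exact congrArg (fun z => φ (Subtype.val z)) hi
  have h6 := congrArg (fun σ : Perm (Fin n) => σ.cycleType.sum) hi'
  simp only [cycleType_conj, hk', sum_cycleType] at h6
  have := Finset.card_le_card (support_zpow_le (φ g) i)
  rw [h6, ← sum_cycleType, hg] at this
  revert this
  decide

theorem alternating_six (h : IsThreeFixAction G Ω) (ψ : G ≃* alternatingGroup (Fin 6)) :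
    (Nat.card Ω = 6 ∧ ActsAsNaturalAlternating 6 G Ω) ∨
      Nat.card Ω = 15 ∧ ∃ H : Subgroup G, Nat.card H = 24 ∧ ActsAsOnCosets G Ω H := by
  have : Finite G := Finite.of_equiv _ ψ.symm.toEquiv
  have hG : Nat.card G = 360 := card_of_mulEquiv_alternatingGroup (by norm_num) ψ rfl
  let φ : G →* Perm (Fin 6) := (alternatingGroup (Fin 6)).subtype.comp ψ.toMonoidHom
  have hφ : Function.Injective φ := Subtype.val_injective.comp ψ.injective
  have hr : ∀ σ, sign σ = 1 → σ ∈ φ.range := fun σ hσ =>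
    ⟨ψ.symm ⟨σ, mem_alternatingGroup.2 hσ⟩, by simp [φ]⟩
  have hs : ∀ g, sign (φ g) = 1 := fun g => mem_alternatingGroup.1 (ψ g).2
  have h5 : ∀ g, (φ g).cycleType = {5} → fixCard Ω g % 5 = Nat.card Ω % 5 ∧ fixCard Ω g ≤ 3 := by
    intro g hg
    have ho : orderOf g = 5 := by rw [← orderOf_injective φ hφ, ← lcm_cycleType, hg]; rfl
    have hg1 : g ≠ 1 := by rintro rfl; rw [orderOf_one] at ho; omega
    exact ⟨(h.card_modEq Nat.prime_five (ho ▸ pow_orderOf_eq_one g)).symm, h.fixCard_le_three hg1⟩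
  -- A cycle type whose elements commute with an odd permutation forms a single class of the
  -- alternating group.
  have hrep : ∀ (τ κ : Perm (Fin 6)), sign κ = -1 → κ * τ = τ * κ → ∀ g k,
      (φ g).cycleType = τ.cycleType → (φ k).cycleType = τ.cycleType →
      fixCard Ω g = fixCard Ω k := by
    intro τ κ hκ hc g k hg hk
    obtain ⟨a, ha, hag⟩ := exists_even_conj hg hκ hc
    obtain ⟨b, hb, hbk⟩ := exists_even_conj hk hκ hc
    obtain ⟨c, hc⟩ := hr (a * b⁻¹) (by rw [map_mul, map_inv, ha, hb]; rfl)
    rw [← fixCard_conj k c]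
    congr 1
    apply hφ
    rw [map_mul, map_mul, map_inv, hc, ← hag, ← hbk]
    group
  obtain ⟨f, hf⟩ := exists_classFunction (Ω := Ω) φ fun g k hgk => by
    have hT := cycleType_mem_evenSixTypes (hs g)
    simp only [evenSixTypes, List.map_cons, List.map_nil, List.mem_cons, List.not_mem_nil,
      or_false] at hT
    rcases hT with hm | hm | hm | hm | hm | hm <;> rw [hm] at hgk
    · exact hrep 1 c[0, 1] (by decide) (by decide) _ _ (hm.trans (by decide))
        (hgk.symm.trans (by decide))
    · exact hrep (c[0, 1] * c[2, 3]) c[0, 1] (by decide) (by decide) _ _ (hm.trans (by decide))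
        (hgk.symm.trans (by decide))
    · exact hrep c[0, 1, 2] c[3, 4] (by decide) (by decide) _ _ (hm.trans (by decide))
        (hgk.symm.trans (by decide))
    · exact hrep (c[0, 1, 2] * c[3, 4, 5]) (c[0, 3] * c[1, 4] * c[2, 5]) (by decide) (by decide)
        _ _ (hm.trans (by decide)) (hgk.symm.trans (by decide))
    · exact hrep (c[0, 1, 2, 3] * c[4, 5]) c[4, 5] (by decide) (by decide)
        _ _ (hm.trans (by decide)) (hgk.symm.trans (by decide))
    -- No odd permutation centralizes a five-cycle here; instead the count is determined by being at
    -- most 3 and congruent to `|Ω|` modulo 5.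
    · have h1 := h5 g hm
      have h2 := h5 k hgk.symm
      omega
  have h0 := classFunction_zero hf
  have hsum := h.sum_classFunction hφ hf (l := evenSixTypes) (by decide +kernel)
    (fun σ => ⟨fun ⟨g, hg⟩ => hg ▸ cycleType_mem_evenSixTypes (hs g),
      fun hσ => hr σ (sign_eq_one_of_mem_evenSixTypes hσ)⟩)
    fun x hx => card_of_mem_sixTypes x (evenSixTypes_subset x hx)
  obtain ⟨g, hg⟩ := h.exists_classFunction_eq_three hf
  have hgT := cycleType_mem_evenSixTypes (hs g)
  have hN := h.card_mem_filter_dvd (by rw [hG])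
  have h6 := h.six_le_card (by rw [hG])
  have hb := h.classFunction_mem hφ hf (p := 2) Nat.prime_two (hr (c[0, 1] * c[2, 3]) (by decide))
    (m := {2, 2}) (m' := 0) (by decide) (by decide) rfl (by decide)
  have hd := h.classFunction_mem hφ hf (p := 3) Nat.prime_three (hr c[0, 1, 2] (by decide))
    (m := {3}) (m' := 0) (by decide) (by decide) rfl (by decide)
  have he := h.classFunction_mem hφ hf (p := 3) Nat.prime_three
    (hr (c[0, 1, 2] * c[3, 4, 5]) (by decide))
    (m := {3, 3}) (m' := 0) (by decide) (by decide) rfl (by decide)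
  have hg4 := h.classFunction_mem hφ hf (p := 2) Nat.prime_two
    (hr (c[0, 1, 2, 3] * c[4, 5]) (by decide))
    (m := {4, 2}) (m' := {2, 2}) (by decide) (by decide) rfl (by decide)
  have hp := h.classFunction_mem hφ hf (p := 5) Nat.prime_five (hr c[0, 1, 2, 3, 4] (by decide))
    (m := {5}) (m' := 0) (by decide) (by decide) rfl (by decide)
  obtain ⟨ω, -⟩ := h.nonregular
  have hmul := h.card_mul ω
  have h9 : f {3} = 0 ∨ f {3, 3} = 0 ∨ 9 ∣ 360 / Nat.card Ω := by
    by_contra! h9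
    obtain ⟨a, ha⟩ := hr c[0, 1, 2] (by decide)
    obtain ⟨b, hb⟩ := hr (c[0, 1, 2] * c[3, 4, 5]) (by decide)
    have ha3 : (φ a).cycleType = {3} := by rw [ha]; decide
    have hb3 : (φ b).cycleType = {3, 3} := by rw [hb]; decide
    refine h9.2.2 ?_
    rw [← hG, ← hmul, Nat.mul_div_cancel_left _ (by omega)]
    exact h.nine_dvd hφ ha3 hb3 (by rw [hf, ha3]; exact h9.1) (by rw [hf, hb3]; exact h9.2.1) ω
  rw [hG, h0] at hb hd he hp
  rw [hG] at hg4 hN hsum hmul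
  simp only [evenSixTypes, List.map_cons, List.map_nil, List.sum_cons, List.sum_nil, h0] at hsum
  simp only [evenSixTypes, List.map_cons, List.map_nil, List.mem_cons, List.not_mem_nil] at hgT
  rcases alternating_six_numeric _ hN _ hb.1 _ hd.1 _ he.1 h9 _ hg4.1 hg4.2 _ hp.1 (by omega) (by
      rcases hgT with hm | hm | hm | hm | hm | hm | hm <;>
        first
        | exact hm.elim
        | (rw [hm] at hg; first | (simp only [hg, List.mem_cons, true_or, or_true]; done) | omega))
    with h6 | h15
  · exact Or.inl ⟨h6, h.actsAsNaturalAlternating h6 (by rw [hG]; rfl)⟩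
  · rw [h15] at hmul
    exact Or.inr ⟨h15, _, by omega, h.actsAsOnCosets ω⟩

end IsThreeFixAction

theorem mainTheorem10 (n : ℕ) (G : Type*) [Group G]
    (hG : Nonempty (G ≃* alternatingGroup (Fin n)) ∨ Nonempty (G ≃* Equiv.Perm (Fin n)))
    (Ω : Type*) [MulAction G Ω] (hΩ : IsThreeFixAction G Ω) :
    n ∈ ({5, 6, 7, 8} : Set ℕ) ∧
    ( -- (1)
      (n = 5 ∧
        (Nonempty (G ≃* alternatingGroup (Fin 5)) ∨ Nonempty (G ≃* Equiv.Perm (Fin 5))) ∧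
        Nat.card Ω = 15 ∧ ∃ P : Sylow 2 G, ActsAsOnCosets G Ω (P : Subgroup G)) ∨
      -- (2)
      (n = 5 ∧ Nonempty (G ≃* Equiv.Perm (Fin 5)) ∧
        Nat.card Ω = 5 ∧ ActsAsNaturalSymmetric 5 G Ω) ∨
      -- (3)
      (n = 6 ∧ Nonempty (G ≃* alternatingGroup (Fin 6)) ∧
        Nat.card Ω = 6 ∧ ActsAsNaturalAlternating 6 G Ω) ∨
      -- (4)
      (n = 6 ∧ Nonempty (G ≃* alternatingGroup (Fin 6)) ∧
        Nat.card Ω = 15 ∧ ∃ H : Subgroup G, Nat.card H = 24 ∧ ActsAsOnCosets G Ω H) ∨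
      -- (5)
      (n = 7 ∧ Nonempty (G ≃* alternatingGroup (Fin 7)) ∧
        Nat.card Ω = 15 ∧ ∃ H : Subgroup G,
          Nonempty (H ≃* Matrix.ProjectiveSpecialLinearGroup (Fin 2) (ZMod 7)) ∧
          ActsAsOnCosets G Ω H) ∨
      -- (6)
      (n = 7 ∧ Nonempty (G ≃* alternatingGroup (Fin 7)) ∧
        Nat.card Ω = 360 ∧ ∃ P : Sylow 7 G, ActsAsOnCosets G Ω (P : Subgroup G)) ∨
      -- (7)
      (n = 8 ∧ Nonempty (G ≃* alternatingGroup (Fin 8)) ∧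
        Nat.card Ω = 2880 ∧ ∃ P : Sylow 7 G, ActsAsOnCosets G Ω (P : Subgroup G)) ) := by

  rcases hG with ⟨⟨ψ⟩⟩ | ⟨⟨ψ⟩⟩
  · have h5 := hΩ.five_le_of_alternating ψ
    rcases (by omega : n = 5 ∨ n = 6 ∨ 7 ≤ n) with rfl | rfl | hn
    · exact ⟨by simp, Or.inl ⟨rfl, Or.inl ⟨ψ⟩, hΩ.alternating_five ψ⟩⟩
    · refine ⟨by simp, ?_⟩
      rcases hΩ.alternating_six ψ with ⟨h6, hn⟩ | ⟨h15, hH⟩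
      · exact Or.inr (Or.inr (Or.inl ⟨rfl, ⟨ψ⟩, h6, hn⟩))
      · exact Or.inr (Or.inr (Or.inr (Or.inl ⟨rfl, ⟨ψ⟩, h15, hH⟩)))
    · rcases hΩ.alternating_of_seven_le hn ψ with ⟨rfl, hc, hH⟩ | ⟨rfl, hc, hH⟩ | ⟨rfl, hc, hH⟩
      · exact ⟨by simp, Or.inr (Or.inr (Or.inr (Or.inr (Or.inl ⟨rfl, ⟨ψ⟩, hc, hH⟩))))⟩
      · exact ⟨by simp, Or.inr (Or.inr (Or.inr (Or.inr (Or.inr (Or.inl ⟨rfl, ⟨ψ⟩, hc, hH⟩)))))⟩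
      · exact ⟨by simp, Or.inr (Or.inr (Or.inr (Or.inr (Or.inr (Or.inr ⟨rfl, ⟨ψ⟩, hc, hH⟩)))))⟩
  · have h5 := hΩ.five_le_of_symmetric ψ
    have h7 := hΩ.degree_lt_seven_of_symmetric ψ
    rcases (by omega : n = 5 ∨ n = 6) with rfl | rfl
    · refine ⟨by simp, ?_⟩
      rcases hΩ.symmetric_five ψ with ⟨h15, hP⟩ | ⟨h5, hn⟩
      · exact Or.inl ⟨rfl, Or.inr ⟨ψ⟩, h15, hP⟩
      · exact Or.inr (Or.inl ⟨rfl, ⟨ψ⟩, h5, hn⟩)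
    · exact (hΩ.not_symmetric_six ψ).elim
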